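/- **Setting.** Let $N\ge1$, $1\le S\le N$, let $L=(L_1,\dots,L_S)$ be positive integers with $\sum_s L_s=N$, put $N_0=0$, $N_s=L_1+\dots+L_s$ and $B_s=\{N_{s-1}+1,\dots,N_s\}$. Let $\dot W$ be a real symmetric $N\times N$ matrix with nonnegative off-diagonal entries and zero row sums which has $N$ distinct eigenvalues and whose diagonal block $\hat W_s=(\dot W_{ij})_{i,j\in B_s}$ has $L_s$ distinct eigenvalues for every $s$; put $W_\varepsilon=\mathrm{Id}+\varepsilon\dot W$. Let $\beta\in\mathbb R^S$ satisfy $e^{-2\pi ik\beta_s}\ne e^{-2\pi ik\beta_t}$ for all $s\ne t$ and all $k\in\mathbb Z\setminus\{0\}$, and let $\alpha_j=\beta_s$ for $j\in B_s$. On $L^2(M)$, $M=\{1,\dots,N\}\times\mathbb R/\mathbb Z$ (counting measure times Lebesgue measure), let $$(\mathcal P_\varepsilon F)(j,x)=\sum_{i=1}^N (W_\varepsilon)_{ji}F(i,x-\alpha_j).$$ Fix $k\in\mathbb Z$. Write $\omega_s=e^{-2\pi ik\beta_s}$, $D=\mathrm{Diag}(e^{-2\pi ik\alpha_1},\dots,e^{-2\pi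 ik\alpha_N})$, $\hat W_L=\mathrm{diag}(\hat W_1,\dots,\hat W_S)$, let $\pi_s$ be the orthogonal projection of $\mathbb C^N$ onto the vectors supported in $B_s$, and $\langle v,w\rangle=\sum_j v_j\overline{w_j}$. **Labelling.** On some interval $0<\varepsilon<\gamma$ the eigenvalues of $\mathcal P_\varepsilon$ with (generalised) eigenfunctions of the form $f(j)e^{2\pi ikx}$, counted with algebraic multiplicity among such functions, can be labelled as continuous functions $\varepsilon\mapsto\lambda^{(\ell)}_{k,\varepsilon}$, $\ell=1,\dots,N$, with $\lambda^{(\ell)}_{k,\varepsilon}\to e^{-2\pi ik\alpha_\ell}$ as $\varepsilon\to0^+$; if $S=1$ or $k=0$, this is possible on $(0,\gamma)$ for every $\gamma>0$. For any such labelling on any $(0,\gamma)$, let $F^{(\ell)}_{k,\varepsilon}$ be an eigenfunction of $\mathcal P_\varepsilon$ of this form for $\lambda^{(\ell)}_{k,\varepsilon}$, and $\Pi^{(\ell)}_{k,\varepsilon}$ the $L^2$-orthogonal projection onto its span. **Theorem.** For every such labelling the $N$ eigenvalues $\lambda^{(\ell)}_{k,\varepsilon}$ are distinct for all small $\varepsilon>0$,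 and there are $\hat\lambda^{(\ell)},\doublehat\lambda^{(\ell)}\in\mathbb C$, an orthonormal basis $f^{(1)},\dots,f^{(N)}$ of $\mathbb C^N$, and $\hat f^{(1)},\dots,\hat f^{(N)}\in\mathbb C^N$ such that, with $F^{(\ell)}(j,x)=f^{(\ell)}(j)e^{2\pi ikx}$, $\hat F^{(\ell)}(j,x)=\hat f^{(\ell)}(j)e^{2\pi ikx}$ and $\Pi^{(\ell)}$ the orthogonal projection onto $\operatorname{span}F^{(\ell)}$, as $\varepsilon\to0^+$, $$\lambda^{(\ell)}_{k,\varepsilon}=e^{-2\pi ik\alpha_\ell}+\varepsilon\hat\lambda^{(\ell)}+\varepsilon^2\doublehat\lambda^{(\ell)}+o(\varepsilon^2),$$ $$\Pi^{(\ell)}_{k,\varepsilon}=\Pi^{(\ell)}+\varepsilon\left(\langle\cdot,F^{(\ell)}\rangle\hat F^{(\ell)}+\langle\cdot,\hat F^{(\ell)}\rangle F^{(\ell)}\right)+o(\varepsilon),$$ where $o(\varepsilon)$ is a finite-rank operator on $L^2(M)$ with operator norm $o(\varepsilon)$, and $\langle F^{(\ell)},\hat F^{(\ell)}\rangle=0$.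 Moreover $\arg\hat\lambda^{(\ell)}=\arg e^{-2\pi ik\alpha_\ell}+\pi$ (mod $2\pi$) whenever $\hat\lambda^{(\ell)}\ne0$. 1. If $S=1$ or $k=0$: $e^{-2\pi ik\alpha_1}\dot W f^{(\ell)}=\hat\lambda^{(\ell)}f^{(\ell)}$, $\doublehat\lambda^{(\ell)}=0$, $\hat f^{(\ell)}=0$, and both remainders vanish identically on $(0,\gamma)$. 2. If $S>1$ and $k\ne0$: $D\hat W_Lf^{(\ell)}=\hat\lambda^{(\ell)}f^{(\ell)}$ and, if $\ell\in B_{s_\ell}$, then $f^{(\ell)}$ is supported in $B_{s_\ell}$, $$\hat f^{(\ell)}=\sum_{s\ne s_\ell}\ \sum_{r\in B_{s_\ell}\setminus\{\ell\}}\frac{\langle\pi_sD\dot Wf^{(\ell)},\pi_s\dot WD^{*}f^{(r)}\rangle}{(\hat\lambda^{(\ell)}-\hat\lambda^{(r)})(\omega_{s_\ell}-\omega_s)}f^{(r)}+\sum_{s\ne s_\ell}\ \sum_{r\in B_s}\frac{\langle D\dot Wf^{(\ell)},f^{(r)}\rangle}{\omega_{s_\ell}-\omega_s}f^{(r)},$$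 $$\doublehat\lambda^{(\ell)}=\sum_{s\ne s_\ell}\frac{\langle\pi_sD\dot Wf^{(\ell)},\pi_s\dot WD^{*}f^{(\ell)}\rangle}{\omega_{s_\ell}-\omega_s}.$$ -/

import Mathlib

open MeasureTheory Filter Topology Asymptotics Set

noncomputable section

namespace BandedRotation

/-! ### The phase space and its `L²` space -/

/-- The phase space `M = {1, …, N} × 𝕊¹` (fibres are numbered from `0`), with `𝕊¹ = ℝ / ℤ`. -/
abbrev PhaseSpace (N : ℕ) : Type := Fin N × AddCircle (1 : ℝ)

/-- Counting measure on the fibres times normalised Lebesgue measure on the circle. With this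
normalisation `‖F‖_{L²(M)} = ‖f‖_{ℂ^N}` for `F(j,x) = f(j) e^{2π i k x}`. -/
def phaseMeasure (N : ℕ) : Measure (PhaseSpace N) :=
  (Measure.count : Measure (Fin N)).prod AddCircle.haarAddCircle

instance (N : ℕ) : IsFiniteMeasure (phaseMeasure N) := by
  unfold phaseMeasure; infer_instance

/-- The complex Hilbert space `L²(M)`. -/
abbrev L2M (N : ℕ) : Type := Lp ℂ 2 (phaseMeasure N)

/-! ### The transfer operator -/

/-- The map `(j, x) ↦ (i, x - α_j)`. -/
def shiftTo {N : ℕ} (α : Fin N → ℝ) (i : Fin N) (p : PhaseSpace N) : PhaseSpace N :=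
  (i, p.2 - (α p.1 : AddCircle (1 : ℝ)))

theorem measurable_shiftTo {N : ℕ} (α : Fin N → ℝ) (i : Fin N) : Measurable (shiftTo α i) := by
  have h : Measurable (fun j : Fin N => ((α j : ℝ) : AddCircle (1 : ℝ))) :=
    measurable_of_countable _
  exact measurable_const.prodMk (measurable_snd.sub (h.comp measurable_fst))

theorem map_shiftTo_le {N : ℕ} (α : Fin N → ℝ) (i : Fin N) :
    (phaseMeasure N).map (shiftTo α i) ≤ (N : ENNReal) • phaseMeasure N := by
  refine Measure.le_iff.2 fun s hs => ?_
  have hpre : ∀ j : Fin N, (AddCircle.haarAddCircle : Measure (AddCircle (1 : ℝ)))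
      (Prod.mk j ⁻¹' (shiftTo α i ⁻¹' s)) = AddCircle.haarAddCircle (Prod.mk i ⁻¹' s) := by
    intro j
    have : Prod.mk j ⁻¹' (shiftTo α i ⁻¹' s) =
        (fun x : AddCircle (1 : ℝ) => x - ((α j : ℝ) : AddCircle (1 : ℝ))) ⁻¹'
          (Prod.mk i ⁻¹' s) := rfl
    simp only [this, sub_eq_add_neg]
    exact measure_preimage_add_right _ _ _
  rw [Measure.map_apply (measurable_shiftTo α i) hs, Measure.smul_apply, phaseMeasure,
    Measure.prod_apply (measurable_shiftTo α i hs), Measure.prod_apply hs,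
    lintegral_count, lintegral_count, tsum_fintype, tsum_fintype,
    Finset.sum_congr rfl fun j _ => hpre j, Finset.sum_const, Finset.card_univ,
    Fintype.card_fin, nsmul_eq_mul, smul_eq_mul]
  gcongr
  exact Finset.single_le_sum
    (f := fun j => (AddCircle.haarAddCircle : Measure (AddCircle (1 : ℝ))) (Prod.mk j ⁻¹' s))
    (fun _ _ => zero_le) (Finset.mem_univ i)

theorem quasiMeasurePreserving_shiftTo {N : ℕ} (α : Fin N → ℝ) (i : Fin N) :
    Measure.QuasiMeasurePreserving (shiftTo α i) (phaseMeasure N) (phaseMeasure N) :=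
  ⟨measurable_shiftTo α i,
    (Measure.absolutelyContinuous_of_le (map_shiftTo_le α i)).trans
      Measure.smul_absolutelyContinuous⟩

/-- The function `(j, x) ↦ ∑ i, W j i * F (i, x - α_j)`. -/
def transferFun {N : ℕ} (W : Matrix (Fin N) (Fin N) ℝ) (α : Fin N → ℝ) (F : PhaseSpace N → ℂ)
    (p : PhaseSpace N) : ℂ :=
  ∑ i, (W p.1 i : ℂ) * F (i, p.2 - (α p.1 : AddCircle (1 : ℝ)))

theorem memLp_transferFun {N : ℕ} (W : Matrix (Fin N) (Fin N) ℝ) (α : Fin N → ℝ)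
    {F : PhaseSpace N → ℂ} (hF : MemLp F 2 (phaseMeasure N)) :
    MemLp (transferFun W α F) 2 (phaseMeasure N) := by
  refine memLp_finsetSum _ fun i _ => ?_
  have h1 : MemLp (fun p => F (shiftTo α i p)) 2 (phaseMeasure N) :=
    (hF.of_measure_le_smul (ENNReal.natCast_ne_top N) (map_shiftTo_le α i)).comp_of_map
      (measurable_shiftTo α i).aemeasurable
  have hm : Measurable (fun p : PhaseSpace N => (W p.1 i : ℂ)) :=
    (measurable_of_countable (fun j : Fin N => (W j i : ℂ))).comp measurable_fst
  refine h1.of_le_mul (c := ∑ j, ‖(W j i : ℂ)‖)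
    (hm.aestronglyMeasurable.mul h1.aestronglyMeasurable) (Eventually.of_forall fun p => ?_)
  simp only [norm_mul]
  refine mul_le_mul_of_nonneg_right ?_ (norm_nonneg _)
  exact Finset.single_le_sum (f := fun j => ‖(W j i : ℂ)‖) (fun _ _ => norm_nonneg _)
    (Finset.mem_univ p.1)

theorem transferFun_congr {N : ℕ} (W : Matrix (Fin N) (Fin N) ℝ) (α : Fin N → ℝ)
    {F G : PhaseSpace N → ℂ} (h : F =ᵐ[phaseMeasure N] G) :
    transferFun W α F =ᵐ[phaseMeasure N] transferFun W α G := by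
  have h' : ∀ᵐ p ∂phaseMeasure N, ∀ i, F (shiftTo α i p) = G (shiftTo α i p) :=
    ae_all_iff.2 fun i => (quasiMeasurePreserving_shiftTo α i).ae h
  filter_upwards [h'] with p hp
  exact Finset.sum_congr rfl fun i _ => congrArg _ (hp i)

/-- The transfer operator on `L²(M)`: `(P F)(j, x) = ∑ i, W j i * F (i, x - α_j)`. -/
def transferOp {N : ℕ} (W : Matrix (Fin N) (Fin N) ℝ) (α : Fin N → ℝ) : L2M N →ₗ[ℂ] L2M N where
  toFun F := (memLp_transferFun W α (Lp.memLp F)).toLp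
  map_add' F G := by
    rw [← MemLp.toLp_add, MemLp.toLp_eq_toLp_iff]
    refine (transferFun_congr W α (Lp.coeFn_add F G)).trans (Eventually.of_forall fun p => ?_)
    simp [transferFun, mul_add, Finset.sum_add_distrib]
  map_smul' c F := by
    rw [RingHom.id_apply, ← MemLp.toLp_const_smul, MemLp.toLp_eq_toLp_iff]
    refine (transferFun_congr W α (Lp.coeFn_smul c F)).trans (Eventually.of_forall fun p => ?_)
    simp [transferFun, Finset.mul_sum, mul_left_comm]

/-- The separable function `F(j, x) = f(j) e^{2π i k x}`, as an element of `L²(M)`. -/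
def mode {N : ℕ} (k : ℤ) : (Fin N → ℂ) →ₗ[ℂ] L2M N where
  toFun f := ContinuousMap.toLp 2 (phaseMeasure N) ℂ
    ⟨fun p => f p.1 * fourier k p.2, by fun_prop⟩
  map_add' f g := by
    rw [← map_add]; congr 1; ext p; simp [add_mul]
  map_smul' c f := by
    rw [RingHom.id_apply, ← map_smul]; congr 1; ext p; simp [mul_assoc]

/-- `⟨v, w⟩ = ∑ j, v_j * conj w_j`. -/
def cinner {N : ℕ} (v w : Fin N → ℂ) : ℂ := ∑ j, v j * star (w j)

/-! ### Bands -/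

/-- `L = (L_1, …, L_S)` is a band-width vector for `N` fibres. -/
structure IsBandWidth (N : ℕ) {S : ℕ} (L : Fin S → ℕ) : Prop where
  pos : ∀ s, 0 < L s
  sum_eq : ∑ s, L s = N

/-- The band `B_s`. With `N_s = L_1 + … + L_s`, the fibre with (zero-based) number `j` is in `B_s`
if `N_{s-1} ≤ j < N_s`. -/
def band (N : ℕ) {S : ℕ} (L : Fin S → ℕ) (s : Fin S) : Finset (Fin N) :=
  {j | ∑ t ∈ Finset.Iio s, L t ≤ (j : ℕ) ∧ (j : ℕ) < ∑ t ∈ Finset.Iic s, L t}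

/-- `α` is the banded vector with band vector `β` and band-width vector `L`. -/
def IsBanded {N S : ℕ} (L : Fin S → ℕ) (β : Fin S → ℝ) (α : Fin N → ℝ) : Prop :=
  ∀ s, ∀ j ∈ band N L s, α j = β s

/-- `e^{-2π i k a}`. -/
def phase (k : ℤ) (a : ℝ) : ℂ := Complex.exp (-2 * Real.pi * Complex.I * k * a)

/-- The set `Γ` of band vectors whose phases are pairwise distinct for all nonzero `k`. -/
def Gam (S : ℕ) : Set (Fin S → ℝ) :=
  {β | ∀ k : ℤ, k ≠ 0 → ∀ s t : Fin S, s ≠ t → phase k (β s) ≠ phase k (β t)}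

/-- `W_ε = Id + ε Ẇ`. -/
def Weps {N : ℕ} (Wdot : Matrix (Fin N) (Fin N) ℝ) (ε : ℝ) : Matrix (Fin N) (Fin N) ℝ :=
  1 + ε • Wdot

/-- The family `W_ε = Id + ε Ẇ` is `L`-admissible. -/
structure IsAdmissible {N S : ℕ} (L : Fin S → ℕ) (Wdot : Matrix (Fin N) (Fin N) ℝ) : Prop where
  symm : Wdot.IsSymm
  nonneg : ∀ i j, i ≠ j → 0 ≤ Wdot i j
  row_sum : ∀ i, ∑ j, Wdot i j = 0
  /-- `Ẇ` has `N` distinct eigenvalues. -/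
  simple : (spectrum ℝ Wdot).ncard = N
  /-- The diagonal block of `Ẇ` on `B_s` has `L_s` distinct eigenvalues. -/
  simple_block : ∀ s, (spectrum ℝ (Wdot.submatrix (fun j : {j // j ∈ band N L s} => (j : Fin N))
    (fun j : {j // j ∈ band N L s} => (j : Fin N)))).ncard = L s

/-! ### Matrices -/

/-- `Ẇ` as a complex matrix. -/
def cW {N : ℕ} (Wdot : Matrix (Fin N) (Fin N) ℝ) : Matrix (Fin N) (Fin N) ℂ :=
  Wdot.map Complex.ofReal

/-- `Diag(e^{-2π i k α_1}, …, e^{-2π i k α_N})`; for the banded vector `α` with data `β`, `L` this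
is the block-scalar matrix `D_{k,β,L}`. -/
def Dmat {N : ℕ} (k : ℤ) (α : Fin N → ℝ) : Matrix (Fin N) (Fin N) ℂ :=
  Matrix.diagonal fun j => phase k (α j)

/-- The block-diagonal matrix `Ŵ_L`: the entries of `Ẇ` with both indices in a common band. -/
def hatW {N S : ℕ} (L : Fin S → ℕ) (Wdot : Matrix (Fin N) (Fin N) ℝ) :
    Matrix (Fin N) (Fin N) ℂ :=
  Matrix.of fun i j => if ∃ s, i ∈ band N L s ∧ j ∈ band N L s then (Wdot i j : ℂ) else 0

/-- The orthogonal projection `π_s` of `ℂ^N` onto the vectors supported in `B_s`. -/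
def bandProj {N S : ℕ} (L : Fin S → ℕ) (s : Fin S) (v : Fin N → ℂ) : Fin N → ℂ :=
  fun j => if j ∈ band N L s then v j else 0

/-- `⟨π_s D Ẇ v, π_s Ẇ D* w⟩`. -/
def coupling {N S : ℕ} (L : Fin S → ℕ) (Wdot : Matrix (Fin N) (Fin N) ℝ) (k : ℤ)
    (α : Fin N → ℝ) (s : Fin S) (v w : Fin N → ℂ) : ℂ :=
  cinner (bandProj L s ((Dmat k α * cW Wdot).mulVec v))
    (bandProj L s ((cW Wdot * Dmat (-k) α).mulVec w))

/-- The explicit first-order response of the `ℓ`-th eigenvector, where `ℓ ∈ B_{s₀}`, in terms of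
the limiting eigenvectors `f` and of the first-order responses `lamHat` of the eigenvalues. -/
def fHatFormula {N S : ℕ} (L : Fin S → ℕ) (Wdot : Matrix (Fin N) (Fin N) ℝ) (k : ℤ)
    (β : Fin S → ℝ) (α : Fin N → ℝ) (lamHat : Fin N → ℂ) (f : Fin N → Fin N → ℂ)
    (s₀ : Fin S) (ℓ : Fin N) : Fin N → ℂ :=
  (∑ s ∈ Finset.univ.erase s₀, ∑ r ∈ (band N L s₀).erase ℓ,
    ((1 / (lamHat ℓ - lamHat r)) * (1 / (phase k (β s₀) - phase k (β s))) *
      coupling L Wdot k α s (f ℓ) (f r)) • f r) +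
  ∑ s ∈ Finset.univ.erase s₀, ∑ r ∈ band N L s,
    ((1 / (phase k (β s₀) - phase k (β s))) *
      cinner ((Dmat k α * cW Wdot).mulVec (f ℓ)) (f r)) • f r

/-- The explicit second-order response of the `ℓ`-th eigenvalue, where `ℓ ∈ B_{s₀}`. -/
def lamHatHatFormula {N S : ℕ} (L : Fin S → ℕ) (Wdot : Matrix (Fin N) (Fin N) ℝ) (k : ℤ)
    (β : Fin S → ℝ) (α : Fin N → ℝ) (f : Fin N → Fin N → ℂ) (s₀ : Fin S) (ℓ : Fin N) : ℂ :=
  ∑ s ∈ Finset.univ.erase s₀,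
    (1 / (phase k (β s₀) - phase k (β s))) * coupling L Wdot k α s (f ℓ) (f ℓ)

/-! ### Labelled eigendata and eigenprojections -/

/-- `lam ℓ ε` and `mode k (g ℓ ε)`, `ℓ : Fin N`, `0 < ε < γ`, are a labelling of the eigenvalues
and of the eigenfunctions of `P_ε` with Fourier index `k`: for each `ε` the list `lam · ε` contains
every eigenvalue as often as its algebraic multiplicity in the space of functions
`f(j) e^{2π i k x}`, each `lam ℓ` is continuous in `ε` and converges to `e^{-2π i k α_ℓ}`, and
`mode k (g ℓ ε)` is an eigenfunction for `lam ℓ ε`. -/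
structure IsLabelledEigendata {N : ℕ} (Wdot : Matrix (Fin N) (Fin N) ℝ) (α : Fin N → ℝ) (k : ℤ)
    (γ : ℝ) (lam : Fin N → ℝ → ℂ) (g : Fin N → ℝ → Fin N → ℂ) : Prop where
  pos : 0 < γ
  multiplicity : ∀ ε ∈ Ioo 0 γ, ∀ z : ℂ, {ℓ | lam ℓ ε = z}.ncard =
    Module.finrank ℂ ↥(Module.End.maxGenEigenspace (transferOp (Weps Wdot ε) α) z ⊓
      LinearMap.range (mode (N := N) k))
  continuousOn : ∀ ℓ, ContinuousOn (lam ℓ) (Ioo 0 γ)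
  tendsto : ∀ ℓ, Tendsto (lam ℓ) (𝓝[>] 0) (𝓝 (phase k (α ℓ)))
  eigenfunction : ∀ ε ∈ Ioo 0 γ, ∀ ℓ, g ℓ ε ≠ 0 ∧
    transferOp (Weps Wdot ε) α (mode k (g ℓ ε)) = lam ℓ ε • mode k (g ℓ ε)

/-- The `L²`-orthogonal projection onto the line spanned by `F`. -/
def lineProj {N : ℕ} (F : L2M N) : L2M N →L[ℂ] L2M N :=
  (Submodule.span ℂ {F}).starProjection

/-- The operator `G ↦ ⟨G, A⟩ B`, where `⟨G, A⟩ = ∫ G * conj A`. -/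
def rankOneOp {N : ℕ} (A B : L2M N) : L2M N →L[ℂ] L2M N :=
  InnerProductSpace.rankOne ℂ B A

end BandedRotation

end

noncomputable section

namespace BandedRotation

/-! ### Fourier modes and the fibre matrices -/

/-! The functions `f(j) e^{2πikx}` with fixed `k` form an invariant subspace on which the transfer
operator acts as the matrix `D(1 + εẆ)` (`transferOp_mode`), with matching generalised eigenspaces.
Everything reduces to perturbing the diagonal matrix `D`.

If all phases agree, `D` is scalar: the eigenvectors of `Ẇ` do not move and the eigenvalues are
affine in `ε` (`isBranchSystem_of_scalar`). Otherwise the eigenspaces of `D` are the bands, and the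
degeneracy is resolved at first order: in a basis of eigenvectors of the blocks `Ŵ_s`, the part of
`DẆ` inside each band is diagonal with distinct entries. The rescaled eigenvalue equation then has
an invertible linearisation at `ε = 0`, so the implicit function theorem yields branches
(`exists_branch`) whose initial values are the explicit responses (`branchInit_self`,
`sum_branchInit_smul`).

For small `ε` the branches are `N` distinct eigenvalues, hence all of them. By connectedness any
continuous labelling is a fixed permutation of the branches (`exists_perm`); comparison of limits at
`0` shows that it preserves phases, hence bands in the second case, and the formulas are equivariant
under such permutations. Simplicity identifies the eigenlines, and `starProjection_span_eq` expands
their projections. The argument of the linear response comes from `dotProduct_mulVec_nonpos`: the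
first-order eigenvalues are phases times nonpositive reals. -/

theorem cinner_eq_star_dotProduct {N : ℕ} (v w : Fin N → ℂ) : cinner v w = v ⬝ᵥ star w := rfl

/-- `mode k` is isometric from `ℂ^N` to `L²(M)`. -/
theorem inner_mode {N : ℕ} (k : ℤ) (f g : Fin N → ℂ) :
    inner ℂ (mode k f) (mode k g) = cinner g f := by
  have h : ∀ p : PhaseSpace N, (g p.1 * fourier k p.2) * star (f p.1 * fourier k p.2) =
      g p.1 * star (f p.1) := by
    intro p
    have h1 : (fourier k p.2 : ℂ) * star (fourier k p.2 : ℂ) = 1 := by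
      rw [Complex.star_def, Complex.mul_conj, Complex.normSq_eq_norm_sq,
        fourier_apply, Circle.norm_coe]
      simp
    rw [star_mul']
    linear_combination (g p.1 * star (f p.1)) * h1
  have h2 := ContinuousMap.inner_toLp (𝕜 := ℂ) (phaseMeasure N)
    ⟨fun p : PhaseSpace N => f p.1 * fourier k p.2, by fun_prop⟩
    ⟨fun p : PhaseSpace N => g p.1 * fourier k p.2, by fun_prop⟩
  refine h2.trans ?_
  simp only [ContinuousMap.coe_mk]
  have h3 : (fun p : PhaseSpace N => (g p.1 * fourier k p.2) *
      (starRingEnd ℂ) (f p.1 * fourier k p.2)) = fun p => (fun j => g j * star (f j)) p.1 :=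
    funext h
  rw [h3]
  refine (integral_fun_fst (fun j => g j * star (f j))).trans ?_
  simp [cinner, integral_fintype, Measure.real]

open scoped ComplexOrder in
theorem mode_injective {N : ℕ} (k : ℤ) : Function.Injective (mode (N := N) k) := by
  rw [← LinearMap.ker_eq_bot, LinearMap.ker_eq_bot']
  intro f hf
  have h := inner_mode k f f
  rw [hf, inner_zero_left, cinner_eq_star_dotProduct] at h
  exact dotProduct_self_star_eq_zero.1 h.symm

/-- The matrix by which `P_ε` acts on the functions `f(j) e^{2π i k x}`. -/
def fiberMat {N : ℕ} (Wdot : Matrix (Fin N) (Fin N) ℝ) (α : Fin N → ℝ) (k : ℤ) (ε : ℝ) :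
    Matrix (Fin N) (Fin N) ℂ :=
  Dmat k α * cW (Weps Wdot ε)

theorem fiberMat_mulVec {N : ℕ} (Wdot : Matrix (Fin N) (Fin N) ℝ) (α : Fin N → ℝ) (k : ℤ)
    (ε : ℝ) (v : Fin N → ℂ) : (fiberMat Wdot α k ε).mulVec v =
      (Dmat k α).mulVec v + (ε : ℂ) • (Dmat k α * cW Wdot).mulVec v := by
  have h : cW (Weps Wdot ε) = 1 + (ε : ℂ) • cW Wdot := by
    ext i j
    by_cases hij : i = j <;> simp [cW, Weps, hij]
  rw [fiberMat, h, Matrix.mul_add, Matrix.mul_one, Matrix.add_mulVec, Matrix.mul_smul,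
    Matrix.smul_mulVec]

theorem transferOp_mode {N : ℕ} (Wdot : Matrix (Fin N) (Fin N) ℝ) (α : Fin N → ℝ) (k : ℤ)
    (ε : ℝ) (v : Fin N → ℂ) : transferOp (Weps Wdot ε) α (mode k v) =
      mode k ((fiberMat Wdot α k ε).mulVec v) := by
  have hc : ∀ f : Fin N → ℂ, (mode k f : PhaseSpace N → ℂ) =ᵐ[phaseMeasure N]
      fun p => f p.1 * fourier k p.2 := fun f => ContinuousMap.coeFn_toLp _ _
  refine Lp.ext ((MemLp.coeFn_toLp (memLp_transferFun _ α (Lp.memLp (mode k v)))).trans ?_)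
  refine (transferFun_congr _ α (hc v)).trans (EventuallyEq.trans ?_ (hc _).symm)
  refine Eventually.of_forall fun p => ?_
  have hf : (fourier k (p.2 - (α p.1 : AddCircle (1 : ℝ))) : ℂ) =
      phase k (α p.1) * fourier k p.2 := by
    rw [sub_eq_add_neg, fourier_apply, fourier_apply, smul_add, AddCircle.toCircle_add,
      Circle.coe_mul, ← fourier_apply, ← fourier_apply, ← AddCircle.coe_neg, fourier_coe_apply,
      phase, mul_comm]
    congr 2
    push_cast
    ring
  simp only [transferFun, hf, fiberMat, Dmat, ← Matrix.mulVec_mulVec, Matrix.mulVec_diagonal]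
  simp only [Matrix.mulVec, dotProduct, cW, Matrix.map_apply, Finset.mul_sum, Finset.sum_mul]
  exact Finset.sum_congr rfl fun i _ => by ring

/-- `mode k` is injective and intertwines every power of the shifted operator with the same power of
the shifted fibre matrix, so vectors killed by some power correspond. -/
theorem maxGenEigenspace_inf_range_mode {N : ℕ} (Wdot : Matrix (Fin N) (Fin N) ℝ)
    (α : Fin N → ℝ) (k : ℤ) (ε : ℝ) (z : ℂ) :
    Module.End.maxGenEigenspace (transferOp (Weps Wdot ε) α) z ⊓
      LinearMap.range (mode (N := N) k) =
    (Module.End.maxGenEigenspace (Matrix.toLin' (fiberMat Wdot α k ε)) z).map (mode k) := by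
  have key : ∀ (n : ℕ) (v : Fin N → ℂ),
      ((transferOp (Weps Wdot ε) α - z • (1 : Module.End ℂ (L2M N))) ^ n) (mode k v) =
      mode k (((Matrix.toLin' (fiberMat Wdot α k ε) -
        z • (1 : Module.End ℂ (Fin N → ℂ))) ^ n) v) := by
    intro n
    induction n with
    | zero => intro v; simp
    | succ n ih =>
      intro v
      rw [pow_succ, pow_succ, Module.End.mul_apply, Module.End.mul_apply, ← ih]
      congr 1
      simp [transferOp_mode]
  ext F
  simp only [Submodule.mem_inf, LinearMap.mem_range, Submodule.mem_map,
    Module.End.mem_maxGenEigenspace]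
  constructor
  · rintro ⟨⟨n, hn⟩, v, rfl⟩
    refine ⟨v, ⟨n, mode_injective k ?_⟩, rfl⟩
    rw [← key, hn, map_zero]
  · rintro ⟨v, ⟨n, hn⟩, rfl⟩
    exact ⟨⟨n, by rw [key, hn, map_zero]⟩, v, rfl⟩

theorem finrank_maxGenEigenspace_inf_range_mode {N : ℕ} (Wdot : Matrix (Fin N) (Fin N) ℝ)
    (α : Fin N → ℝ) (k : ℤ) (ε : ℝ) (z : ℂ) :
    Module.finrank ℂ ↥(Module.End.maxGenEigenspace (transferOp (Weps Wdot ε) α) z ⊓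
      LinearMap.range (mode (N := N) k)) =
    Module.finrank ℂ
      ↥(Module.End.maxGenEigenspace (Matrix.toLin' (fiberMat Wdot α k ε)) z) := by
  rw [maxGenEigenspace_inf_range_mode]
  exact (LinearEquiv.finrank_eq (Submodule.equivMapOfInjective _ (mode_injective k) _)).symm

/-! ### Matrices with simple spectrum -/

section SimpleSpectrum

variable {n : Type*} [Fintype n] [DecidableEq n]

/-- As many distinct eigenvalues as the dimension exhaust the roots of the characteristic
polynomial, so each root has algebraic multiplicity one. -/
theorem finrank_maxGenEigenspace_of_injective (A : Matrix n n ℂ) (z : n → ℂ)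
    (hz : Function.Injective z) (v : n → n → ℂ) (hv : ∀ i, v i ≠ 0)
    (hA : ∀ i, A.mulVec (v i) = z i • v i) (w : ℂ) :
    Module.finrank ℂ ↥(Module.End.maxGenEigenspace (Matrix.toLin' A) w) =
      {i | z i = w}.ncard := by
  have hroots : A.charpoly.roots = Finset.univ.val.map z := by
    symm
    refine Multiset.eq_of_le_of_card_le ?_ ?_
    · rw [Multiset.le_iff_subset (Finset.univ.nodup.map hz)]
      intro x hx
      obtain ⟨i, -, rfl⟩ := Multiset.mem_map.1 hx
      rw [Polynomial.mem_roots A.charpoly_monic.ne_zero]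
      rw [← Matrix.charpoly_toLin', ← Module.End.hasEigenvalue_iff_isRoot_charpoly]
      exact Module.End.hasEigenvalue_of_hasEigenvector
        ⟨Module.End.mem_eigenspace_iff.2 (by simpa using hA i), hv i⟩
    · refine (Polynomial.card_roots' _).trans ?_
      rw [Matrix.charpoly_natDegree_eq_dim]
      simp
  rw [LinearMap.finrank_maxGenEigenspace_eq, Matrix.charpoly_toLin', ← Polynomial.count_roots,
    hroots, Multiset.count_map, Set.ncard_eq_toFinset_card']
  simp [Finset.card_def, eq_comm]

/-- The generalised eigenspace of a simple eigenvalue is a line. This identifies an arbitrary choice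
of eigenfunction with a branch vector up to scale. -/
theorem exists_smul_eq_of_injective (A : Matrix n n ℂ) (z : n → ℂ)
    (hz : Function.Injective z) (v : n → n → ℂ) (hv : ∀ i, v i ≠ 0)
    (hA : ∀ i, A.mulVec (v i) = z i • v i) {i : n} {g : n → ℂ} (hg : g ≠ 0)
    (hAg : A.mulVec g = z i • g) : ∃ c : ℂ, c ≠ 0 ∧ g = c • v i := by
  have h1 : Module.finrank ℂ ↥(Module.End.maxGenEigenspace (Matrix.toLin' A) (z i)) = 1 := by
    rw [finrank_maxGenEigenspace_of_injective A z hz v hv hA]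
    have : {j | z j = z i} = {i} := by ext j; simp [hz.eq_iff]
    rw [this, Set.ncard_singleton]
  have hmem : ∀ {u : n → ℂ}, A.mulVec u = z i • u →
      u ∈ Module.End.maxGenEigenspace (Matrix.toLin' A) (z i) := fun {u} hu =>
    (Module.End.mem_maxGenEigenspace _ _ _).2 ⟨1, by simp [hu]⟩
  obtain ⟨c, hc⟩ := (finrank_eq_one_iff_of_nonzero' (⟨v i, hmem (hA i)⟩ :
    Module.End.maxGenEigenspace (Matrix.toLin' A) (z i))
    (by simpa [Subtype.ext_iff] using hv i)).1 h1 ⟨g, hmem hAg⟩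
  have hc' : c • v i = g := congrArg Subtype.val hc
  refine ⟨c, ?_, hc'.symm⟩
  rintro rfl
  exact hg (by rw [← hc', zero_smul])

end SimpleSpectrum

/-! ### Perturbation of a diagonal matrix

The eigenvector and the eigenvalue of `diag(w) + ε c` that continue the `i`-th coordinate vector
are sought in the form `e_i + ε ∑_{p ≠ i} x_p e_p` and `w_i + ε c_ii + ε² x_i`. After division by
powers of `ε` the eigenvalue equation becomes an analytic equation for `x` that is affine and
uniquely solvable at `ε = 0`. -/

section Branch

variable {n : Type*} [Fintype n] [DecidableEq n]

/-- The linear part, at `ε = 0`, of the rescaled eigenvalue equation. -/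
def branchLinear (w : n → ℂ) (c : n → n → ℂ) (i : n) : (n → ℂ) →ₗ[ℂ] (n → ℂ) where
  toFun x q :=
    -- The eigenvector has `i`-th coordinate `1`, so slot `i` is free to hold the second-order
    -- eigenvalue unknown. Rows with `w q = w i` start at order `ε²` and are divided by `ε²`; the
    -- other rows are divided by `ε`.
    if q = i then x i - ∑ p ∈ Finset.univ.erase i, c i p * x p
    else if w q = w i then c i i * x q - ∑ p ∈ Finset.univ.erase i, c q p * x p
    else (w i - w q) * x q
  map_add' x y := by
    ext q
    simp only [Pi.add_apply, mul_add, Finset.sum_add_distrib]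
    split_ifs <;> ring
  map_smul' a x := by
    ext q
    have h : ∀ q, ∑ p ∈ Finset.univ.erase i, c q p * (a * x p) =
        a * ∑ p ∈ Finset.univ.erase i, c q p * x p := fun q => by
      rw [Finset.mul_sum]
      exact Finset.sum_congr rfl fun p _ => by ring
    simp only [Pi.smul_apply, smul_eq_mul, RingHom.id_apply, h]
    split_ifs <;> ring

/-- The solution at `ε = 0` of the rescaled eigenvalue equation. -/
def branchInit (w : n → ℂ) (c : n → n → ℂ) (i q : n) : ℂ :=
  if q = i then ∑ p with w p ≠ w i, c i p * (c p i / (w i - w p))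
  else if w q = w i then
    (∑ p with w p ≠ w i, c q p * (c p i / (w i - w p))) / (c i i - c q q)
  else c q i / (w i - w q)

/-- The part of the rescaled eigenvalue equation that vanishes at `ε = 0`, divided by `ε`. -/
def branchRemainder (w : n → ℂ) (c : n → n → ℂ) (i : n) (ε : ℂ) (x : n → ℂ) (q : n) : ℂ :=
  if q = i then 0
  else if w q = w i then x i * x q
  else (c i i + ε * x i) * x q - ∑ p ∈ Finset.univ.erase i, c q p * x p

/-- The rescaled eigenvalue equation. -/
def branchEquation (w : n → ℂ) (c : n → n → ℂ) (i : n) (e : ℂ × (n → ℂ)) : n → ℂ :=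
  branchLinear w c i e.2 - (fun q => if w q = w i then 0 else c q i) +
    e.1 • branchRemainder w c i e.1 e.2

variable {w : n → ℂ} {c : n → n → ℂ} {i : n}

/-- Inside the block of `i` the matrix `c` is diagonal, so a row of that block sees only its
diagonal entry and the coordinates outside the block. -/
theorem sum_erase_eq_of_block (hc : ∀ p q, p ≠ q → w p = w q → c p q = 0) {q : n}
    (hq : w q = w i) (x : n → ℂ) : ∑ p ∈ Finset.univ.erase i, c q p * x p =
      (if q = i then 0 else c q q * x q) + ∑ p with w p ≠ w i, c q p * x p := by
  have h1 : ∑ p ∈ Finset.univ.erase i, c q p * x p =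
      ∑ p, if p = i then 0 else c q p * x p := by
    rw [← Finset.add_sum_erase _ (fun p => if p = i then 0 else c q p * x p) (Finset.mem_univ i)]
    simp only [if_pos, zero_add]
    exact Finset.sum_congr rfl fun p hp => by rw [if_neg (Finset.ne_of_mem_erase hp)]
  have h2 : (if q = i then 0 else c q q * x q) =
      ∑ p, if p = q then (if q = i then 0 else c q q * x q) else 0 := by simp
  rw [h1, h2, Finset.sum_filter, ← Finset.sum_add_distrib]
  refine Finset.sum_congr rfl fun p _ => ?_
  by_cases hpi : p = i
  · subst hpi
    by_cases hpq : p = q <;> simp [hpq]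
  · by_cases hpq : p = q
    · subst hpq
      simp [hpi, hq]
    · by_cases hw : w p = w i
      · simp [hpi, hpq, hw, hc q p (Ne.symm hpq) (hq.trans hw.symm)]
      · simp [hpi, hpq, hw]

/-- The system is triangular: coordinates outside the block are decoupled with factors `w i - w q`,
the remaining block coordinates then have factors `c i i - c q q`, and slot `i` comes last with
factor `1`. -/
theorem branchLinear_injective (hc : ∀ p q, p ≠ q → w p = w q → c p q = 0)
    (hd : ∀ q, q ≠ i → w q = w i → c q q ≠ c i i) :
    Function.Injective (branchLinear w c i) := by
  rw [← LinearMap.ker_eq_bot, LinearMap.ker_eq_bot']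
  intro x hx
  have hq : ∀ q, branchLinear w c i x q = 0 := fun q => by rw [hx]; rfl
  simp only [branchLinear, LinearMap.coe_mk, AddHom.coe_mk] at hq
  have ho : ∀ q, w q ≠ w i → x q = 0 := by
    intro q hw
    have hqi : q ≠ i := fun h => hw (by rw [h])
    have := hq q
    rw [if_neg hqi, if_neg hw] at this
    exact (mul_eq_zero.1 this).resolve_left (sub_ne_zero.2 (Ne.symm hw))
  have hs : ∀ q, ∑ p with w p ≠ w i, c q p * x p = 0 := fun q =>
    Finset.sum_eq_zero fun p hp => by rw [ho p (Finset.mem_filter.1 hp).2, mul_zero]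
  ext q
  by_cases hqi : q = i
  · subst hqi
    have := hq q
    rw [if_pos rfl, sum_erase_eq_of_block hc rfl, hs, if_pos rfl] at this
    simpa using this
  by_cases hw : w q = w i
  · have := hq q
    rw [if_neg hqi, if_pos hw, sum_erase_eq_of_block hc hw, hs, if_neg hqi, add_zero,
      ← sub_mul] at this
    exact (mul_eq_zero.1 this).resolve_left (sub_ne_zero.2 (Ne.symm (hd q hqi hw)))
  · exact ho q hw

theorem branchEquation_init (hc : ∀ p q, p ≠ q → w p = w q → c p q = 0)
    (hd : ∀ q, q ≠ i → w q = w i → c q q ≠ c i i) :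
    branchEquation w c i (0, branchInit w c i) = 0 := by
  have hs : ∀ q, ∑ p with w p ≠ w i, c q p * branchInit w c i p =
      ∑ p with w p ≠ w i, c q p * (c p i / (w i - w p)) := fun q =>
    Finset.sum_congr rfl fun p hp => by
      have hw := (Finset.mem_filter.1 hp).2
      have hpi : p ≠ i := fun h => hw (by rw [h])
      rw [branchInit, if_neg hpi, if_neg hw]
  ext q
  simp only [branchEquation, branchLinear, LinearMap.coe_mk, AddHom.coe_mk, zero_smul, add_zero,
    Pi.sub_apply, Pi.zero_apply]
  by_cases hqi : q = i
  · subst hqi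
    rw [if_pos rfl, if_pos rfl, sum_erase_eq_of_block hc rfl, hs, if_pos rfl, branchInit,
      if_pos rfl]
    ring
  by_cases hw : w q = w i
  · have h0 : c i i - c q q ≠ 0 := sub_ne_zero.2 (Ne.symm (hd q hqi hw))
    rw [if_neg hqi, if_pos hw, if_pos hw, sum_erase_eq_of_block hc hw, hs, if_neg hqi, branchInit,
      if_neg hqi, if_pos hw]
    field_simp
    ring
  · have h0 : w i - w q ≠ 0 := sub_ne_zero.2 (Ne.symm hw)
    rw [if_neg hqi, if_neg hw, if_neg hw, branchInit, if_neg hqi, if_neg hw]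
    field_simp
    ring

theorem contDiff_branchEquation : ContDiff ℂ 1 (branchEquation w c i) := by
  have h1 : ContDiff ℂ 1 fun e : ℂ × (n → ℂ) => branchLinear w c i e.2 :=
    (LinearMap.toContinuousLinearMap (branchLinear w c i)).contDiff.comp contDiff_snd
  have h2 : ContDiff ℂ 1 fun e : ℂ × (n → ℂ) => branchRemainder w c i e.1 e.2 := by
    rw [contDiff_pi]
    intro q
    simp only [branchRemainder]
    split_ifs <;> fun_prop
  exact (h1.sub contDiff_const).add (contDiff_fst.smul h2)

/-- Existence, continuity and initial value of the rescaled eigenvalue branch. -/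
theorem exists_branch (hc : ∀ p q, p ≠ q → w p = w q → c p q = 0)
    (hd : ∀ q, q ≠ i → w q = w i → c q q ≠ c i i) :
    ∃ x : ℂ → n → ℂ, x 0 = branchInit w c i ∧ ∀ᶠ ε in 𝓝 0, ContinuousAt x ε ∧
      ∀ q, w q * (if q = i then 1 else ε * x ε q) +
          ε * ∑ p, c q p * (if p = i then 1 else ε * x ε p) =
        (w i + ε * c i i + ε ^ 2 * x ε i) * (if q = i then 1 else ε * x ε q) := by
  have hcd : ContDiffAt ℂ 1 (branchEquation w c i) (0, branchInit w c i) :=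
    contDiff_branchEquation.contDiffAt
  set T := LinearMap.toContinuousLinearMap (branchLinear w c i) with hT
  have hinv : (fderiv ℂ (branchEquation w c i) (0, branchInit w c i) ∘L
      .inr ℂ ℂ (n → ℂ)).IsInvertible := by
    have hg : HasFDerivAt (fun x : n → ℂ => ((0 : ℂ), x)) (.inr ℂ ℂ (n → ℂ))
        (branchInit w c i) := hasFDerivAt_prodMk_right _ _
    have h1 := (hcd.differentiableAt one_ne_zero).hasFDerivAt.comp (branchInit w c i) hg
    -- The remainder carries a factor `ε`, so on the slice `ε = 0` the equation is affine in `x` and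
    -- its derivative is the linear part.
    have h2 : HasFDerivAt (fun x : n → ℂ => branchEquation w c i (0, x)) T (branchInit w c i) := by
      have : (fun x : n → ℂ => branchEquation w c i (0, x)) =
          fun x => T x - (fun q => if w q = w i then 0 else c q i) := by
        ext x q
        simp [branchEquation, hT]
      rw [this]
      exact T.hasFDerivAt.sub_const _
    rw [h1.unique h2]
    exact ⟨(LinearEquiv.ofInjectiveEndo _
      (branchLinear_injective hc hd)).toContinuousLinearEquiv, by ext; rfl⟩
  refine ⟨hcd.implicitFunction one_ne_zero hinv, hcd.implicitFunction_apply_self one_ne_zero hinv,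
    ?_⟩
  have hcont : ∀ᶠ ε in 𝓝 (0 : ℂ), ContinuousAt (hcd.implicitFunction one_ne_zero hinv) ε :=
    ((hcd.contDiffAt_implicitFunction one_ne_zero hinv).eventually (by simp)).mono
      fun ε h => h.continuousAt
  filter_upwards [hcont, hcd.eventually_apply_implicitFunction one_ne_zero hinv] with ε h1 h2
  refine ⟨h1, fun q => ?_⟩
  set x := hcd.implicitFunction one_ne_zero hinv ε
  -- The implicit function keeps the equation at its value at the base point, which is zero.
  rw [branchEquation_init hc hd] at h2
  have hsum : ∀ q, ∑ p, c q p * (if p = i then 1 else ε * x p) =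
      c q i + ε * ∑ p ∈ Finset.univ.erase i, c q p * x p := by
    intro q
    rw [← Finset.add_sum_erase _ _ (Finset.mem_univ i), if_pos rfl, mul_one, Finset.mul_sum]
    congr 1
    refine Finset.sum_congr rfl fun p hp => ?_
    rw [if_neg (Finset.ne_of_mem_erase hp)]
    ring
  have h3 := congrFun h2 q
  simp only [branchEquation, branchLinear, branchRemainder, LinearMap.coe_mk, AddHom.coe_mk,
    Pi.sub_apply, Pi.add_apply, Pi.smul_apply, smul_eq_mul, Pi.zero_apply] at h3
  rw [hsum]
  by_cases hqi : q = i
  · subst hqi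
    simp only [if_pos] at h3 ⊢
    -- The powers of `ε` that were divided out are multiplied back, so `ε = 0` needs no separate
    -- treatment.
    linear_combination (-ε ^ 2) * h3
  by_cases hw : w q = w i
  · simp only [if_neg hqi, if_pos hw] at h3 ⊢
    rw [hc q i hqi hw, hw]
    linear_combination (-ε ^ 2) * h3
  · simp only [if_neg hqi, if_neg hw] at h3 ⊢
    linear_combination (-ε) * h3

end Branch

/-! ### Projections onto perturbed lines -/

section Line

variable {E : Type*} [NormedAddCommGroup E] [InnerProductSpace ℂ E]

theorem starProjection_span_singleton (v : E) : (Submodule.span ℂ {v}).starProjection =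
    ((‖v‖ ^ 2 : ℝ) : ℂ)⁻¹ • InnerProductSpace.rankOne ℂ v v := by
  ext x
  rw [Submodule.starProjection_singleton, _root_.smul_apply,
    InnerProductSpace.rankOne_apply, smul_smul, div_eq_inv_mul]
  rfl

theorem tendsto_rankOne {β : Type*} {l : Filter β} {y z : β → E} {y₀ z₀ : E}
    (hy : Tendsto y l (𝓝 y₀)) (hz : Tendsto z l (𝓝 z₀)) :
    Tendsto (fun t => (InnerProductSpace.rankOne ℂ (y t) (z t) : E →L[ℂ] E)) l
      (𝓝 (InnerProductSpace.rankOne ℂ y₀ z₀)) := by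
  rw [tendsto_iff_norm_sub_tendsto_zero] at hy hz ⊢
  have hz' : Tendsto (fun t => ‖z t - z₀‖ + ‖z₀‖) l (𝓝 (0 + ‖z₀‖)) := hz.add_const _
  have h := (hy.mul hz').add (hz.const_mul ‖y₀‖)
  rw [zero_mul, mul_zero, add_zero] at h
  refine squeeze_zero (fun t => norm_nonneg _) (fun t => ?_) h
  have h1 : (InnerProductSpace.rankOne ℂ (y t) (z t) - InnerProductSpace.rankOne ℂ y₀ z₀ :
      E →L[ℂ] E) = InnerProductSpace.rankOne ℂ (y t - y₀) (z t) +
        InnerProductSpace.rankOne ℂ y₀ (z t - z₀) := by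
    ext x
    simp only [_root_.add_apply, _root_.sub_apply, InnerProductSpace.rankOne_apply,
      inner_sub_left]
    module
  have h2 : ‖z t‖ ≤ ‖z t - z₀‖ + ‖z₀‖ := by simpa using norm_add_le (z t - z₀) z₀
  rw [h1]
  refine (norm_add_le _ _).trans ?_
  rw [InnerProductSpace.norm_rankOne, InnerProductSpace.norm_rankOne]
  gcongr

/-- The error of the first-order expansion of the projection onto the line through `a + t u`,
divided by `t`. -/
def lineError (a b : E) (t : ℝ) (u : E) : E →L[ℂ] E :=
  -- For a unit vector `a` orthogonal to `u`, this coefficient is `(‖a + t u‖⁻² - 1) / t`.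
  ((-(t * ‖u‖ ^ 2) / (1 + t ^ 2 * ‖u‖ ^ 2) : ℝ) : ℂ) •
      InnerProductSpace.rankOne ℂ (a + (t : ℂ) • u) (a + (t : ℂ) • u) +
    (InnerProductSpace.rankOne ℂ (u - b) a + InnerProductSpace.rankOne ℂ a (u - b)) +
    (t : ℂ) • InnerProductSpace.rankOne ℂ u u

/-- An exact identity for every real `t`: `b` is arbitrary and cancels against `lineError`. Only in
the limit is `b` taken to be the limit of `u`, which makes the error small. -/
theorem starProjection_span_eq {a b u : E} (ha : ‖a‖ = 1) (hau : inner ℂ a u = 0) (t : ℝ) :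
    (Submodule.span ℂ {a + (t : ℂ) • u}).starProjection =
      (Submodule.span ℂ {a}).starProjection + (t : ℂ) • (InnerProductSpace.rankOne ℂ b a +
        InnerProductSpace.rankOne ℂ a b) + (t : ℂ) • lineError a b t u := by
  have hnorm : ‖a + (t : ℂ) • u‖ ^ 2 = 1 + t ^ 2 * ‖u‖ ^ 2 := by
    rw [@norm_add_sq ℂ, inner_smul_right, hau, norm_smul, ha]
    simp [mul_pow]
  have hpos : 0 < 1 + t ^ 2 * ‖u‖ ^ 2 := by positivity
  set s : ℂ := ((-(t * ‖u‖ ^ 2) / (1 + t ^ 2 * ‖u‖ ^ 2) : ℝ) : ℂ) with hs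
  have h1 : ((‖a + (t : ℂ) • u‖ ^ 2 : ℝ) : ℂ)⁻¹ = 1 + (t : ℂ) * s := by
    have hne : (1 + (t : ℂ) ^ 2 * (‖u‖ : ℂ) ^ 2) ≠ 0 := by exact_mod_cast hpos.ne'
    rw [hnorm, hs]
    push_cast
    field_simp
    ring
  rw [starProjection_span_singleton, starProjection_span_singleton, h1, ha, lineError, ← hs]
  ext x
  simp only [one_pow, Complex.ofReal_one, inv_one, one_smul, InnerProductSpace.rankOne_apply,
    _root_.add_apply, _root_.smul_apply, inner_add_left, inner_smul_left, inner_sub_left,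
    Complex.conj_ofReal]
  module

theorem tendsto_lineError (a : E) {b : E} {u : ℝ → E} {l : Filter ℝ}
    (hl : Tendsto (fun t : ℝ => t) l (𝓝 0)) (hu : Tendsto u l (𝓝 b)) :
    Tendsto (fun t => lineError a b t (u t)) l (𝓝 0) := by
  have hlc : Tendsto (fun t : ℝ => (t : ℂ)) l (𝓝 0) := by
    have h := (Complex.continuous_ofReal.tendsto 0).comp hl
    rwa [Complex.ofReal_zero] at h
  have hub : Tendsto (fun t => u t - b) l (𝓝 0) := by simpa using hu.sub_const b
  have hF : Tendsto (fun t : ℝ => a + (t : ℂ) • u t) l (𝓝 (a + (0 : ℂ) • b)) :=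
    (hlc.smul hu).const_add a
  have hs : Tendsto (fun t : ℝ => -(t * ‖u t‖ ^ 2) / (1 + t ^ 2 * ‖u t‖ ^ 2)) l
      (𝓝 (-(0 * ‖b‖ ^ 2) / (1 + 0 ^ 2 * ‖b‖ ^ 2))) :=
    ((hl.mul (hu.norm.pow 2)).neg).div (((hl.pow 2).mul (hu.norm.pow 2)).const_add 1) (by simp)
  have hs' : Tendsto (fun t : ℝ => ((-(t * ‖u t‖ ^ 2) / (1 + t ^ 2 * ‖u t‖ ^ 2) : ℝ) : ℂ)) l
      (𝓝 0) := by
    have h := (Complex.continuous_ofReal.tendsto _).comp hs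
    rwa [zero_mul, neg_zero, zero_div, Complex.ofReal_zero] at h
  have h := ((hs'.smul (tendsto_rankOne hF hF)).add
    ((tendsto_rankOne hub (tendsto_const_nhds (x := a))).add
      (tendsto_rankOne (tendsto_const_nhds (x := a)) hub))).add
    (hlc.smul (tendsto_rankOne hu hu))
  rw [zero_smul, zero_smul, map_zero, map_zero, _root_.zero_apply, add_zero, add_zero,
    add_zero] at h
  exact h

/-- The error of the first-order expansion is `o(t)` if `u(t)` converges to `b`. -/
theorem isLittleO_smul_lineError (a : E) {b : E} {u : ℝ → E} {l : Filter ℝ}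
    (hl : Tendsto (fun t : ℝ => t) l (𝓝 0)) (hu : Tendsto u l (𝓝 b)) :
    (fun t : ℝ => (t : ℂ) • lineError a b t (u t)) =o[l] fun t => t := by
  have h1 : (fun t : ℝ => (t : ℂ)) =O[l] fun t : ℝ => t := 
    IsBigO.of_bound 1 (Eventually.of_forall fun t => by simp)
  have h2 := h1.smul_isLittleO ((isLittleO_one_iff ℝ).2 (tendsto_lineError a hl hu))
  simpa using h2

end Line

/-! ### Bands -/

/-- The number of fibres in the first `m` bands. -/
def bandStart {S : ℕ} (L : Fin S → ℕ) (m : ℕ) : ℕ := ∑ t with (t : Fin S).val < m, L t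

theorem mem_band {N S : ℕ} {L : Fin S → ℕ} {s : Fin S} {j : Fin N} :
    j ∈ band N L s ↔ bandStart L s ≤ j ∧ (j : ℕ) < bandStart L (s + 1) := by
  have h1 : Finset.Iio s = Finset.univ.filter fun t : Fin S => t.val < s := by
    ext t; simp
  have h2 : Finset.Iic s = Finset.univ.filter fun t : Fin S => t.val < s + 1 := by
    ext t; simp
  rw [band, Finset.mem_filter, h1, h2]
  simp [bandStart]

theorem bandStart_mono {S : ℕ} (L : Fin S → ℕ) : Monotone (bandStart L) := fun a b hab =>
  Finset.sum_le_sum_of_subset (by intro t; simp; omega)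

theorem bandStart_succ {S : ℕ} (L : Fin S → ℕ) (s : Fin S) :
    bandStart L (s + 1) = bandStart L s + L s := by
  have h : (Finset.univ.filter fun t : Fin S => t.val < s + 1) =
      insert s (Finset.univ.filter fun t : Fin S => t.val < s) := by
    ext t
    simp only [Finset.mem_filter, Finset.mem_univ, true_and, Finset.mem_insert, Fin.ext_iff]
    omega
  rw [bandStart, h, Finset.sum_insert (by simp), add_comm, bandStart]

theorem IsBandWidth.bandStart_eq {N S : ℕ} {L : Fin S → ℕ} (hL : IsBandWidth N L) :
    bandStart L S = N := by
  rw [bandStart, Finset.filter_true_of_mem fun t _ => t.2, hL.sum_eq]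

theorem IsBandWidth.exists_bandIndex {N S : ℕ} {L : Fin S → ℕ} (hL : IsBandWidth N L) :
    ∃ b : Fin N → Fin S, ∀ j s, j ∈ band N L s ↔ b j = s := by
  have hex : ∀ j : Fin N, ∃ s, j ∈ band N L s := by
    intro j
    -- The band of `j` is one less than the least `m` whose first `m` bands contain `j`; this `m` is
    -- positive because zero bands contain nothing.
    have h : ∃ m, (j : ℕ) < bandStart L m := ⟨S, by rw [hL.bandStart_eq]; exact j.2⟩
    have h0 : Nat.find h ≠ 0 := fun h0 => by
      have := Nat.find_spec h
      rw [h0] at this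
      simp [bandStart] at this
    have hS : Nat.find h ≤ S := Nat.find_min' h (by rw [hL.bandStart_eq]; exact j.2)
    have hmin := Nat.find_min h (m := Nat.find h - 1) (by omega)
    refine ⟨⟨Nat.find h - 1, by omega⟩, mem_band.2 ⟨not_lt.1 hmin, ?_⟩⟩
    simpa [Nat.sub_add_cancel (Nat.one_le_iff_ne_zero.2 h0)] using Nat.find_spec h
  choose b hb using hex
  have hlt : ∀ {j : Fin N} {s t : Fin S}, j ∈ band N L s → j ∈ band N L t → ¬ s < t := by
    intro j s t hs ht hst
    have h := bandStart_mono L (show (s : ℕ) + 1 ≤ t from hst)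
    have h1 := (mem_band.1 hs).2
    have h2 := (mem_band.1 ht).1
    omega
  refine ⟨b, fun j s => ⟨fun hs => ?_, fun h => h ▸ hb j⟩⟩
  exact le_antisymm (not_lt.1 (hlt hs (hb j))) (not_lt.1 (hlt (hb j) hs))

theorem IsBandWidth.card_band {N S : ℕ} {L : Fin S → ℕ} (hL : IsBandWidth N L) (s : Fin S) :
    (band N L s).card = L s := by
  have hle : bandStart L (s + 1) ≤ N := hL.bandStart_eq ▸ bandStart_mono L s.2
  have h : (band N L s).map Fin.valEmbedding =
      Finset.Ico (bandStart L s) (bandStart L (s + 1)) := by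
    ext m
    simp only [Finset.mem_map, mem_band, Fin.valEmbedding_apply, Finset.mem_Ico]
    exact ⟨by rintro ⟨j, hj, rfl⟩; exact hj, fun hm => ⟨⟨m, by omega⟩, hm, rfl⟩⟩
  rw [← Finset.card_map Fin.valEmbedding, h, Nat.card_Ico, bandStart_succ]
  omega

/-! ### Eigenbases of symmetric matrices and of their diagonal blocks -/

theorem exists_orthonormal_eigenbasis {n : Type*} [Fintype n] [DecidableEq n]
    (M : Matrix n n ℝ) (hM : M.IsSymm) (hs : (spectrum ℝ M).ncard = Fintype.card n) :
    ∃ (μ : n → ℝ) (v : n → n → ℝ), Function.Injective μ ∧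
      (∀ i j, v i ⬝ᵥ v j = if i = j then 1 else 0) ∧ ∀ i, M.mulVec (v i) = μ i • v i := by
  have hH : M.IsHermitian := by
    rw [Matrix.IsHermitian, Matrix.conjTranspose_eq_transpose_of_trivial]
    exact hM
  refine ⟨hH.eigenvalues, fun i => ⇑(hH.eigenvectorBasis i), ?_, fun i j => ?_,
    hH.mulVec_eigenvectorBasis⟩
  -- The spectrum is the image of the eigenvalue list; an image as large as its source forces
  -- injectivity.
  · rw [hH.spectrum_real_eq_range_eigenvalues, ← Set.image_univ, ← Nat.card_eq_fintype_card,
      ← Set.ncard_univ] at hs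
    exact Set.injOn_univ.1 ((Set.ncard_image_iff Set.finite_univ).1 hs)
  · have h := orthonormal_iff_ite.1 hH.eigenvectorBasis.orthonormal i j
    rw [← h, EuclideanSpace.inner_eq_star_dotProduct, dotProduct_comm]
    simp

/-- An orthonormal system that diagonalises the diagonal blocks of a symmetric matrix. -/
theorem exists_block_eigenbasis {n ι : Type*} [Fintype n] [DecidableEq n]
    (M : Matrix n n ℝ) (hM : M.IsSymm) (B : ι → Finset n) (b : n → ι)
    (hb : ∀ j s, j ∈ B s ↔ b j = s)
    (hs : ∀ s, (spectrum ℝ (M.submatrix (fun j : {j // j ∈ B s} => (j : n))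
      (fun j : {j // j ∈ B s} => (j : n)))).ncard = (B s).card) :
    ∃ (μ : n → ℝ) (v : n → n → ℝ), (∀ i j, b i = b j → μ i = μ j → i = j) ∧
      (∀ i j, b j ≠ b i → v i j = 0) ∧ (∀ i j, v i ⬝ᵥ v j = if i = j then 1 else 0) ∧
      ∀ i j, b j = b i → M.mulVec (v i) j = μ i * v i j := by
  have h := fun s => exists_orthonormal_eigenbasis _ (hM.submatrix _)
    ((hs s).trans (Fintype.card_coe (B s)).symm)
  choose μ v hμ hv hMv using h
  -- Block eigenvectors are extended by zero, which makes different blocks orthogonal through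
  -- disjoint supports.
  let x : ∀ s, {j // j ∈ B s} → n → ℝ := fun s i j => if h : j ∈ B s then v s i ⟨j, h⟩ else 0
  have hx : ∀ s i (F : n → ℝ), ∑ j, F j * x s i j = ∑ j : {j // j ∈ B s}, F j * v s i j := by
    intro s i F
    rw [← Finset.sum_subset (Finset.subset_univ (B s)), ← Finset.sum_coe_sort]
    · exact Finset.sum_congr rfl fun j _ => by simp [x]
    · intro j _ hj
      simp [x, hj]
  have hmem : ∀ i, i ∈ B (b i) := fun i => (hb i _).2 rfl
  have horth : ∀ s t (i : {j // j ∈ B s}) (j : {j // j ∈ B t}),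
      x s i ⬝ᵥ x t j = if (i : n) = j then 1 else 0 := by
    intro s t i j
    rw [dotProduct, hx]
    by_cases hst : s = t
    · subst hst
      have : ∑ q : {j // j ∈ B s}, x s i q * v s j q = v s i ⬝ᵥ v s j :=
        Finset.sum_congr rfl fun q _ => by simp [x]
      rw [this, hv]
      exact if_congr Subtype.ext_iff rfl rfl
    · have h1 : ∀ q ∈ B t, q ∉ B s := fun q hq hq' =>
        hst (((hb q s).1 hq').symm.trans ((hb q t).1 hq))
      have h2 : (i : n) ≠ j := fun hij => h1 j j.2 (hij ▸ i.2)
      rw [Finset.sum_eq_zero fun q _ => by simp [x, h1 q q.2], if_neg h2]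
  refine ⟨fun i => μ (b i) ⟨i, hmem i⟩, fun i => x (b i) ⟨i, hmem i⟩, ?_, ?_, ?_, ?_⟩
  · intro i j hij hμij
    -- The index type of `μ` depends on the block, so the two blocks are first made variables and
    -- then identified.
    have key : ∀ s (hi : i ∈ B s) (t) (hj : j ∈ B t), s = t → μ s ⟨i, hi⟩ = μ t ⟨j, hj⟩ →
        i = j := by
      rintro s hi t hj rfl he
      exact congrArg Subtype.val (hμ s he)
    exact key _ _ _ _ hij hμij
  · intro i j hij
    simp only [x]
    rw [dif_neg fun h => hij ((hb j _).1 h)]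
  · exact fun i j => horth _ _ _ _
  · intro i j hij
    have hj : j ∈ B (b i) := (hb j _).2 hij
    have h1 := congrFun (hMv (b i) ⟨i, hmem i⟩) ⟨j, hj⟩
    rw [Matrix.mulVec, dotProduct, hx]
    simp only [x]
    rw [dif_pos hj]
    exact h1

/-- The quadratic form of a symmetric matrix with nonnegative off-diagonal entries and zero row
sums is nonpositive. -/
theorem dotProduct_mulVec_nonpos {n : Type*} [Fintype n] (M : Matrix n n ℝ) (hM : M.IsSymm)
    (hnn : ∀ i j, i ≠ j → 0 ≤ M i j) (hrow : ∀ i, ∑ j, M i j = 0) (v : n → ℝ) :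
    v ⬝ᵥ M.mulVec v ≤ 0 := by
  -- With zero row and column sums, the quadratic form is `-1/2` times this Dirichlet sum, where the
  -- diagonal entries do not contribute.
  have h0 : 0 ≤ ∑ i, ∑ j, M i j * (v i - v j) ^ 2 := by
    refine Finset.sum_nonneg fun i _ => Finset.sum_nonneg fun j _ => ?_
    by_cases hij : i = j
    · simp [hij]
    · exact mul_nonneg (hnn i j hij) (sq_nonneg _)
  have h1 : ∑ i, ∑ j, M i j * v i ^ 2 = 0 :=
    Finset.sum_eq_zero fun i _ => by rw [← Finset.sum_mul, hrow, zero_mul]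
  have h2 : ∑ i, ∑ j, M i j * v j ^ 2 = 0 := by
    rw [Finset.sum_comm]
    refine Finset.sum_eq_zero fun j _ => ?_
    rw [← Finset.sum_mul, Finset.sum_congr rfl fun i _ => (hM.apply i j).symm, hrow, zero_mul]
  have h3 : v ⬝ᵥ M.mulVec v = ∑ i, ∑ j, M i j * (v i * v j) := by
    simp only [dotProduct, Matrix.mulVec, Finset.mul_sum]
    exact Finset.sum_congr rfl fun i _ => Finset.sum_congr rfl fun j _ => by ring
  have h4 : ∑ i, ∑ j, M i j * (v i - v j) ^ 2 =
      ∑ i, ∑ j, M i j * v i ^ 2 + ∑ i, ∑ j, M i j * v j ^ 2 -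
        2 * ∑ i, ∑ j, M i j * (v i * v j) := by
    simp only [Finset.mul_sum, ← Finset.sum_add_distrib, ← Finset.sum_sub_distrib]
    exact Finset.sum_congr rfl fun i _ => Finset.sum_congr rfl fun j _ => by ring
  linarith

/-! ### Systems of eigenvalue branches -/

/-- The eigenvalue branch with first-order response `lamHat` and rescaled remainder `m`. -/
def branchValue {N : ℕ} (α : Fin N → ℝ) (k : ℤ) (lamHat : Fin N → ℂ) (m : Fin N → ℝ → ℂ)
    (ℓ : Fin N) (ε : ℝ) : ℂ :=
  phase k (α ℓ) + ε * lamHat ℓ + (ε : ℂ) ^ 2 * m ℓ ε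

/-- The vectors `f ℓ + ε u ℓ ε` are, for `0 < ε < γ₀`, eigenvectors of the fibre matrix for the
distinct eigenvalues `branchValue α k lamHat m ℓ ε`. -/
structure IsBranchSystem {N : ℕ} (Wdot : Matrix (Fin N) (Fin N) ℝ) (α : Fin N → ℝ) (k : ℤ)
    (γ₀ : ℝ) (f : Fin N → Fin N → ℂ) (lamHat lamHatHat : Fin N → ℂ) (fHat : Fin N → Fin N → ℂ)
    (m : Fin N → ℝ → ℂ) (u : Fin N → ℝ → Fin N → ℂ) : Prop where
  pos : 0 < γ₀
  orthonormal : ∀ i j, cinner (f i) (f j) = if i = j then 1 else 0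
  orth : ∀ ℓ ε, cinner (u ℓ ε) (f ℓ) = 0
  orth_limit : ∀ ℓ, cinner (fHat ℓ) (f ℓ) = 0
  eigen : ∀ ε ∈ Ioo 0 γ₀, ∀ ℓ, (fiberMat Wdot α k ε).mulVec (f ℓ + (ε : ℂ) • u ℓ ε) =
    branchValue α k lamHat m ℓ ε • (f ℓ + (ε : ℂ) • u ℓ ε)
  injective : ∀ ε ∈ Ioo 0 γ₀, Function.Injective fun ℓ => branchValue α k lamHat m ℓ ε
  continuousOn : ∀ ℓ, ContinuousOn (m ℓ) (Ioo 0 γ₀)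
  tendsto_value : ∀ ℓ, Tendsto (m ℓ) (𝓝[>] 0) (𝓝 (lamHatHat ℓ))
  tendsto_vector : ∀ ℓ, Tendsto (u ℓ) (𝓝[>] 0) (𝓝 (fHat ℓ))

theorem tendsto_ofReal_nhdsGT_zero : Tendsto (fun ε : ℝ => (ε : ℂ)) (𝓝[>] 0) (𝓝 0) := by
  have h := (Complex.continuous_ofReal.tendsto 0).mono_left (nhdsWithin_le_nhds (s := Ioi (0 : ℝ)))
  rwa [Complex.ofReal_zero] at h

theorem span_smul_singleton_eq {E : Type*} [AddCommGroup E] [Module ℂ E] {c : ℂ} (hc : c ≠ 0)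
    (v : E) : Submodule.span ℂ {c • v} = Submodule.span ℂ {v} :=
  Submodule.span_singleton_smul_eq (IsUnit.mk0 c hc) v

namespace IsBranchSystem

variable {N : ℕ} {Wdot : Matrix (Fin N) (Fin N) ℝ} {α : Fin N → ℝ} {k : ℤ} {γ₀ : ℝ}
  {f : Fin N → Fin N → ℂ} {lamHat lamHatHat : Fin N → ℂ} {fHat : Fin N → Fin N → ℂ}
  {m : Fin N → ℝ → ℂ} {u : Fin N → ℝ → Fin N → ℂ}
  {γ : ℝ} {lam : Fin N → ℝ → ℂ} {g : Fin N → ℝ → Fin N → ℂ}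

/-- The correction is orthogonal to `f ℓ`, so the vector has inner product `1` with `f ℓ` for every
`ε`. -/
theorem vector_ne_zero (h : IsBranchSystem Wdot α k γ₀ f lamHat lamHatHat fHat m u) (ℓ : Fin N)
    (ε : ℝ) : f ℓ + (ε : ℂ) • u ℓ ε ≠ 0 := by
  intro h0
  have h1 : inner ℂ (mode k (f ℓ)) (mode k (f ℓ + (ε : ℂ) • u ℓ ε)) = (1 : ℂ) := by
    rw [map_add, map_smul, inner_add_right, inner_smul_right, inner_mode, inner_mode, h.orth,
      h.orthonormal]
    simp
  rw [h0, map_zero, inner_zero_right] at h1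
  exact zero_ne_one h1

theorem continuousOn_branchValue
    (h : IsBranchSystem Wdot α k γ₀ f lamHat lamHatHat fHat m u) (ℓ : Fin N) :
    ContinuousOn (branchValue α k lamHat m ℓ) (Ioo 0 γ₀) := by
  have h1 := h.continuousOn ℓ
  have h2 : ContinuousOn (fun ε : ℝ => (ε : ℂ)) (Ioo 0 γ₀) := Complex.continuous_ofReal.continuousOn
  exact (continuousOn_const.add (h2.mul continuousOn_const)).add ((h2.pow 2).mul h1)

theorem tendsto_branchValue
    (h : IsBranchSystem Wdot α k γ₀ f lamHat lamHatHat fHat m u) (ℓ : Fin N) :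
    Tendsto (branchValue α k lamHat m ℓ) (𝓝[>] 0) (𝓝 (phase k (α ℓ))) := by
  have h1 : Tendsto (branchValue α k lamHat m ℓ) _ _ :=
    ((tendsto_ofReal_nhdsGT_zero.mul_const (lamHat ℓ)).const_add (phase k (α ℓ))).add
      ((tendsto_ofReal_nhdsGT_zero.pow 2).mul (h.tendsto_value ℓ))
  simpa using h1

theorem finrank_eq (h : IsBranchSystem Wdot α k γ₀ f lamHat lamHatHat fHat m u) {ε : ℝ}
    (hε : ε ∈ Ioo 0 γ₀) (z : ℂ) :
    Module.finrank ℂ ↥(Module.End.maxGenEigenspace (transferOp (Weps Wdot ε) α) z ⊓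
      LinearMap.range (mode (N := N) k)) = {ℓ | branchValue α k lamHat m ℓ ε = z}.ncard := by
  rw [finrank_maxGenEigenspace_inf_range_mode]
  exact finrank_maxGenEigenspace_of_injective _ _ (h.injective ε hε) _
    (fun ℓ => h.vector_ne_zero ℓ ε) (h.eigen ε hε) z

theorem isLabelledEigendata (h : IsBranchSystem Wdot α k γ₀ f lamHat lamHatHat fHat m u) :
    IsLabelledEigendata Wdot α k γ₀ (branchValue α k lamHat m)
      fun ℓ ε => f ℓ + (ε : ℂ) • u ℓ ε where
  pos := h.pos
  multiplicity ε hε z := (h.finrank_eq hε z).symm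
  continuousOn := h.continuousOn_branchValue
  tendsto := h.tendsto_branchValue
  eigenfunction ε hε ℓ :=
    ⟨h.vector_ne_zero ℓ ε, by rw [transferOp_mode, h.eigen ε hε, map_smul]⟩

/-- Every labelling agrees for small `ε` with a fixed relabelling of the branches. -/
theorem exists_perm (h : IsBranchSystem Wdot α k γ₀ f lamHat lamHatHat fHat m u)
    (hlam : IsLabelledEigendata Wdot α k γ lam g) :
    ∃ σ : Equiv.Perm (Fin N), ∀ ℓ, phase k (α (σ ℓ)) = phase k (α ℓ) ∧
      ∀ ε ∈ Ioo 0 (min γ γ₀), lam ℓ ε = branchValue α k lamHat m (σ ℓ) ε := by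
  have hpos : 0 < min γ γ₀ := lt_min hlam.pos h.pos
  have hγ : ∀ {ε}, ε ∈ Ioo 0 (min γ γ₀) → ε ∈ Ioo 0 γ := fun hε =>
    ⟨hε.1, hε.2.trans_le (min_le_left _ _)⟩
  have hγ₀ : ∀ {ε}, ε ∈ Ioo 0 (min γ γ₀) → ε ∈ Ioo 0 γ₀ := fun hε =>
    ⟨hε.1, hε.2.trans_le (min_le_right _ _)⟩
  have hcard : ∀ ε ∈ Ioo 0 (min γ γ₀), ∀ z, {ℓ | lam ℓ ε = z}.ncard =
      {ℓ | branchValue α k lamHat m ℓ ε = z}.ncard := fun ε hε z =>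
    (hlam.multiplicity ε (hγ hε) z).trans (h.finrank_eq (hγ₀ hε) z)
  have hex : ∀ ℓ, ∀ ε ∈ Ioo 0 (min γ γ₀), ∃ i, lam ℓ ε = branchValue α k lamHat m i ε := by
    intro ℓ ε hε
    have h1 : 0 < {i | branchValue α k lamHat m i ε = lam ℓ ε}.ncard := by
      rw [← hcard ε hε, Set.ncard_pos]
      exact ⟨ℓ, rfl⟩
    obtain ⟨i, hi⟩ := (Set.ncard_pos).1 h1
    exact ⟨i, hi.symm⟩
  have hconst : ∀ ℓ, ∃ i, ∀ ε ∈ Ioo 0 (min γ γ₀), lam ℓ ε = branchValue α k lamHat m i ε := by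
    intro ℓ
    have : Nonempty (Fin N) := ⟨ℓ⟩
    choose! τ hτ using hex ℓ
    -- Distinct branches stay apart near each `ε₀`, so the index of the branch followed by `lam ℓ`
    -- is locally constant, hence constant on the interval.
    have hτc : ContinuousOn τ (Ioo 0 (min γ γ₀)) := by
      intro ε₀ hε₀
      refine (continuousWithinAt_const (b := τ ε₀)).congr_of_eventuallyEq ?_ rfl
      have hev : ∀ i, i ≠ τ ε₀ → ∀ᶠ ε in 𝓝[Ioo 0 (min γ γ₀)] ε₀,
          lam ℓ ε ≠ branchValue α k lamHat m i ε := by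
        intro i hi
        have c1 : ContinuousWithinAt (lam ℓ) (Ioo 0 (min γ γ₀)) ε₀ :=
          (hlam.continuousOn ℓ).mono (fun _ => hγ) ε₀ hε₀
        have c2 : ContinuousWithinAt (branchValue α k lamHat m i) (Ioo 0 (min γ γ₀)) ε₀ :=
          (h.continuousOn_branchValue i).mono (fun _ => hγ₀) ε₀ hε₀
        have hne : lam ℓ ε₀ - branchValue α k lamHat m i ε₀ ≠ 0 := by
          rw [hτ ε₀ hε₀]
          exact sub_ne_zero.2 fun he => hi (h.injective ε₀ (hγ₀ hε₀) he).symm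
        exact (Filter.Tendsto.eventually_ne (c1.sub c2) hne).mono fun ε => sub_ne_zero.1
      filter_upwards [eventually_all.2 fun i => eventually_imp_distrib_left.2 (hev i),
        self_mem_nhdsWithin] with ε h1 hε
      by_contra hne
      exact h1 (τ ε) hne (hτ ε hε)
    obtain ⟨ε₁, hε₁⟩ : (Ioo 0 (min γ γ₀)).Nonempty := nonempty_Ioo.2 hpos
    refine ⟨τ ε₁, fun ε hε => ?_⟩
    rw [hτ ε hε, isPreconnected_Ioo.constant hτc hε hε₁]
  choose τ hτ using hconst
  -- Equal multiplicities mean that every branch value is attained by some label.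
  have hsurj : Function.Surjective τ := by
    intro i
    obtain ⟨ε, hε⟩ : (Ioo 0 (min γ γ₀)).Nonempty := nonempty_Ioo.2 hpos
    have h1 : 0 < {ℓ | lam ℓ ε = branchValue α k lamHat m i ε}.ncard := by
      rw [hcard ε hε, Set.ncard_pos]
      exact ⟨i, rfl⟩
    obtain ⟨ℓ, hℓ⟩ := (Set.ncard_pos).1 h1
    exact ⟨ℓ, h.injective ε (hγ₀ hε) ((hτ ℓ ε hε).symm.trans hℓ)⟩
  refine ⟨Equiv.ofBijective τ (Finite.injective_iff_bijective.1
    (Finite.injective_iff_surjective.2 hsurj)), fun ℓ => ⟨?_, hτ ℓ⟩⟩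
  refine tendsto_nhds_unique ((h.tendsto_branchValue (τ ℓ)).congr' ?_) (hlam.tendsto ℓ)
  filter_upwards [Ioo_mem_nhdsGT hpos] with ε hε
  exact (hτ ℓ ε hε).symm

/-- Simplicity determines the eigenline, so neither the normalisation of `g` nor its dependence on
`ε` matters. -/
theorem span_mode_eq (h : IsBranchSystem Wdot α k γ₀ f lamHat lamHatHat fHat m u)
    (hlam : IsLabelledEigendata Wdot α k γ lam g) {ℓ i : Fin N} {ε : ℝ} (hε : ε ∈ Ioo 0 γ)
    (hε' : ε ∈ Ioo 0 γ₀) (he : lam ℓ ε = branchValue α k lamHat m i ε) :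
    Submodule.span ℂ {mode k (g ℓ ε)} =
      Submodule.span ℂ {mode k (f i) + (ε : ℂ) • mode k (u i ε)} := by
  obtain ⟨hg, hgε⟩ := hlam.eigenfunction ε hε ℓ
  rw [transferOp_mode, ← map_smul, he] at hgε
  obtain ⟨c, hc, hgc⟩ := exists_smul_eq_of_injective _ _ (h.injective ε hε') _
    (fun ℓ => h.vector_ne_zero ℓ ε) (h.eigen ε hε') hg (mode_injective k hgε)
  rw [hgc, map_smul, span_smul_singleton_eq hc, map_add, map_smul]

/-- The response of an arbitrary labelling in terms of a system of branches. -/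
theorem response (h : IsBranchSystem Wdot α k γ₀ f lamHat lamHatHat fHat m u)
    (hlam : IsLabelledEigendata Wdot α k γ lam g) :
    (∀ᶠ ε in 𝓝[>] (0 : ℝ), Function.Injective fun ℓ => lam ℓ ε) ∧
    ∃ (σ : Equiv.Perm (Fin N)) (r : Fin N → ℝ → ℂ) (R : Fin N → ℝ → L2M N →L[ℂ] L2M N),
      (∀ ℓ, phase k (α (σ ℓ)) = phase k (α ℓ)) ∧
      (∀ ℓ, ∀ ε ∈ Ioo 0 γ, lam ℓ ε =
        phase k (α ℓ) + ε * lamHat (σ ℓ) + (ε : ℂ) ^ 2 * lamHatHat (σ ℓ) + r ℓ ε) ∧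
      (∀ ℓ, r ℓ =o[𝓝[>] 0] fun ε : ℝ => ε ^ 2) ∧
      (∀ ℓ, ∀ ε ∈ Ioo 0 γ, lineProj (mode k (g ℓ ε)) =
        lineProj (mode k (f (σ ℓ))) + (ε : ℂ) •
          (rankOneOp (mode k (f (σ ℓ))) (mode k (fHat (σ ℓ))) +
            rankOneOp (mode k (fHat (σ ℓ))) (mode k (f (σ ℓ)))) + R ℓ ε) ∧
      (∀ ℓ, ∀ ε ∈ Ioo 0 γ, FiniteDimensional ℂ (R ℓ ε).range) ∧
      (∀ ℓ, R ℓ =o[𝓝[>] 0] fun ε : ℝ => ε) ∧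
      (∀ ℓ, ∀ ε ∈ Ioo 0 (min γ γ₀), r ℓ ε = (ε : ℂ) ^ 2 * (m (σ ℓ) ε - lamHatHat (σ ℓ)) ∧
        R ℓ ε = (ε : ℂ) • lineError (mode k (f (σ ℓ))) (mode k (fHat (σ ℓ))) ε
          (mode k (u (σ ℓ) ε))) := by
  obtain ⟨σ, hσ⟩ := h.exists_perm hlam
  have hpos : 0 < min γ γ₀ := lt_min hlam.pos h.pos
  have hγ : ∀ {ε}, ε ∈ Ioo 0 (min γ γ₀) → ε ∈ Ioo 0 γ := fun hε =>
    ⟨hε.1, hε.2.trans_le (min_le_left _ _)⟩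
  have hγ₀ : ∀ {ε}, ε ∈ Ioo 0 (min γ γ₀) → ε ∈ Ioo 0 γ₀ := fun hε =>
    ⟨hε.1, hε.2.trans_le (min_le_right _ _)⟩
  -- The remainders are defined as differences on all of `(0, γ)`; their explicit forms are
  -- available only where the branches exist.
  let r : Fin N → ℝ → ℂ := fun ℓ ε => lam ℓ ε -
    (phase k (α ℓ) + ε * lamHat (σ ℓ) + (ε : ℂ) ^ 2 * lamHatHat (σ ℓ))
  let R : Fin N → ℝ → L2M N →L[ℂ] L2M N := fun ℓ ε => lineProj (mode k (g ℓ ε)) -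
    (lineProj (mode k (f (σ ℓ))) + (ε : ℂ) •
      (rankOneOp (mode k (f (σ ℓ))) (mode k (fHat (σ ℓ))) +
        rankOneOp (mode k (fHat (σ ℓ))) (mode k (f (σ ℓ)))))
  have hr : ∀ ℓ, ∀ ε ∈ Ioo 0 (min γ γ₀),
      r ℓ ε = (ε : ℂ) ^ 2 * (m (σ ℓ) ε - lamHatHat (σ ℓ)) := by
    intro ℓ ε hε
    simp only [r]
    rw [(hσ ℓ).2 ε hε, branchValue, (hσ ℓ).1]
    ring
  have hR : ∀ ℓ, ∀ ε ∈ Ioo 0 (min γ γ₀), R ℓ ε = (ε : ℂ) •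
      lineError (mode k (f (σ ℓ))) (mode k (fHat (σ ℓ))) ε (mode k (u (σ ℓ) ε)) := by
    intro ℓ ε hε
    have hnorm : ‖mode k (f (σ ℓ))‖ = 1 := by
      rw [@norm_eq_sqrt_re_inner ℂ, inner_mode, h.orthonormal]
      simp
    have horth : inner ℂ (mode k (f (σ ℓ))) (mode k (u (σ ℓ) ε)) = 0 := by
      rw [inner_mode, h.orth]
    have h1 := starProjection_span_eq (b := mode k (fHat (σ ℓ))) hnorm horth ε
    rw [sub_eq_iff_eq_add']
    refine Eq.trans ?_ h1
    rw [lineProj]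
    congr 1
    exact h.span_mode_eq hlam (hγ hε) (hγ₀ hε) ((hσ ℓ).2 ε hε)
  have hto : Tendsto (fun ε : ℝ => ε) (𝓝[>] 0) (𝓝 0) := nhdsWithin_le_nhds
  refine ⟨?_, σ, r, R, fun ℓ => (hσ ℓ).1, fun ℓ ε _ => by simp only [r]; ring, fun ℓ => ?_,
    fun ℓ ε _ => by simp only [R]; abel, fun ℓ ε _ => ?_, fun ℓ => ?_,
    fun ℓ ε hε => ⟨hr ℓ ε hε, hR ℓ ε hε⟩⟩
  · filter_upwards [Ioo_mem_nhdsGT hpos] with ε hε i j hij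
    simp only [(hσ _).2 ε hε] at hij
    exact σ.injective (h.injective ε (hγ₀ hε) hij)
  · have h1 : (fun ε : ℝ => (ε : ℂ) ^ 2) =O[𝓝[>] 0] fun ε : ℝ => ε ^ 2 :=
      IsBigO.of_bound 1 (Eventually.of_forall fun ε => by simp)
    have h2 : Tendsto (fun ε => m (σ ℓ) ε - lamHatHat (σ ℓ)) (𝓝[>] 0) (𝓝 0) := by
      simpa using (h.tendsto_value (σ ℓ)).sub_const (lamHatHat (σ ℓ))
    have h3 := h1.mul_isLittleO ((isLittleO_one_iff ℝ).2 h2)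
    simp only [mul_one] at h3
    refine h3.congr' ?_ EventuallyEq.rfl
    filter_upwards [Ioo_mem_nhdsGT hpos] with ε hε
    exact (hr ℓ ε hε).symm
  -- The range of the remainder lies in the span of the perturbed eigenfunction, its limit and the
  -- response.
  · refine Submodule.finiteDimensional_of_le (S₂ := Submodule.span ℂ {mode k (g ℓ ε)} ⊔
      (Submodule.span ℂ {mode k (f (σ ℓ))} ⊔ Submodule.span ℂ {mode k (fHat (σ ℓ))})) ?_
    rintro _ ⟨x, rfl⟩
    have hA := Submodule.starProjection_apply_mem (Submodule.span ℂ {mode k (g ℓ ε)}) x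
    have hB := Submodule.starProjection_apply_mem (Submodule.span ℂ {mode k (f (σ ℓ))}) x
    have hC := Submodule.smul_mem _ (inner ℂ (mode k (f (σ ℓ))) x)
      (Submodule.mem_span_singleton_self (R := ℂ) (mode k (fHat (σ ℓ))))
    have hD := Submodule.smul_mem _ (inner ℂ (mode k (fHat (σ ℓ))) x)
      (Submodule.mem_span_singleton_self (R := ℂ) (mode k (f (σ ℓ))))
    exact Submodule.sub_mem _ (Submodule.mem_sup_left hA) (Submodule.mem_sup_right
      (Submodule.add_mem _ (Submodule.mem_sup_left hB) (Submodule.smul_mem _ _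
        (Submodule.add_mem _ (Submodule.mem_sup_right hC) (Submodule.mem_sup_left hD)))))
  · have hu : Tendsto (fun ε => mode k (u (σ ℓ) ε)) (𝓝[>] 0) (𝓝 (mode k (fHat (σ ℓ)))) :=
      ((LinearMap.continuous_of_finiteDimensional (mode (N := N) k)).tendsto _).comp
        (h.tendsto_vector (σ ℓ))
    refine (isLittleO_smul_lineError (mode k (f (σ ℓ))) hto hu).congr' ?_ EventuallyEq.rfl
    filter_upwards [Ioo_mem_nhdsGT hpos] with ε hε
    exact (hR ℓ ε hε).symm

end IsBranchSystem

/-! ### Phases and complexification -/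

theorem phase_ne_zero (k : ℤ) (a : ℝ) : phase k a ≠ 0 := Complex.exp_ne_zero _

theorem star_phase (k : ℤ) (a : ℝ) : star (phase k a) = phase (-k) a := by
  rw [phase, phase, Complex.star_def, ← Complex.exp_conj]
  congr 1
  simp only [map_mul, map_neg, Complex.conj_ofReal, Complex.conj_I, map_intCast, map_ofNat]
  push_cast
  ring

theorem arg_phase_mul_of_neg (k : ℤ) (a : ℝ) {μ : ℝ} (hμ : μ < 0) :
    ((phase k a * μ).arg : Real.Angle) = ((phase k a).arg : Real.Angle) + Real.pi := by
  rw [Complex.arg_mul_coe_angle (phase_ne_zero k a) (by exact_mod_cast hμ.ne),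
    Complex.arg_ofReal_of_neg hμ]

theorem cW_mulVec_ofReal {N : ℕ} (M : Matrix (Fin N) (Fin N) ℝ) (v : Fin N → ℝ) (j : Fin N) :
    (cW M).mulVec (fun i => (v i : ℂ)) j = (M.mulVec v j : ℝ) := by
  simp [Matrix.mulVec, dotProduct, cW]

theorem cinner_ofReal {N : ℕ} (v w : Fin N → ℝ) :
    cinner (fun j => (v j : ℂ)) (fun j => (w j : ℂ)) = (v ⬝ᵥ w : ℝ) := by
  simp [cinner, dotProduct]

theorem Dmat_mulVec {N : ℕ} (k : ℤ) (α : Fin N → ℝ) (v : Fin N → ℂ) (j : Fin N) :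
    (Dmat k α).mulVec v j = phase k (α j) * v j := by
  rw [Dmat, Matrix.mulVec_diagonal]

/-! ### Orthonormal systems of `N` vectors in `ℂ^N` -/

section Orthonormal

variable {N : ℕ} {f : Fin N → Fin N → ℂ}

theorem cinner_smul_left (a : ℂ) (v w : Fin N → ℂ) : cinner (a • v) w = a * cinner v w := by
  simp [cinner, Finset.mul_sum, mul_assoc]

theorem cinner_sum_left {ι : Type*} (s : Finset ι) (v : ι → Fin N → ℂ) (w : Fin N → ℂ) :
    cinner (∑ i ∈ s, v i) w = ∑ i ∈ s, cinner (v i) w := by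
  simp only [cinner, Finset.sum_apply, Finset.sum_mul]
  exact Finset.sum_comm

theorem star_cinner (v w : Fin N → ℂ) : star (cinner v w) = cinner w v := by
  simp [cinner, mul_comm]

theorem cinner_mulVec_left (A : Matrix (Fin N) (Fin N) ℂ) (v w : Fin N → ℂ) :
    cinner (A.mulVec v) w = cinner v (A.conjTranspose.mulVec w) := by
  rw [cinner_eq_star_dotProduct, cinner_eq_star_dotProduct, Matrix.star_mulVec,
    Matrix.conjTranspose_conjTranspose, dotProduct_comm, Matrix.dotProduct_mulVec, dotProduct_comm]

theorem sum_cinner_smul (hf : ∀ i j, cinner (f i) (f j) = if i = j then 1 else 0)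
    (y : Fin N → ℂ) : ∑ q, cinner y (f q) • f q = y := by
  have h1 : Matrix.of f * (Matrix.of f).conjTranspose = 1 := by
    ext i j
    rw [Matrix.mul_apply, Matrix.one_apply]
    exact hf i j
  -- Orthonormal rows of a square matrix give orthonormal columns, which is completeness of the
  -- system.
  have h2 := mul_eq_one_comm.1 h1
  ext j
  have h3 : ∀ i, ∑ q, star (f q i) * f q j = if i = j then 1 else 0 := by
    intro i
    have := congrFun (congrFun h2 i) j
    rwa [Matrix.mul_apply, Matrix.one_apply] at this
  simp only [Finset.sum_apply, Pi.smul_apply, smul_eq_mul, cinner, Finset.sum_mul]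
  rw [Finset.sum_comm]
  simp only [mul_assoc, ← Finset.mul_sum, h3]
  simp

theorem cinner_eq_sum (hf : ∀ i j, cinner (f i) (f j) = if i = j then 1 else 0)
    (y z : Fin N → ℂ) : cinner y z = ∑ q, cinner y (f q) * cinner (f q) z := by
  conv_lhs => rw [← sum_cinner_smul hf y, cinner_sum_left]
  exact Finset.sum_congr rfl fun q _ => cinner_smul_left _ _ _

end Orthonormal

/-! ### A single phase -/

/-- If all phases agree, the eigenvectors do not depend on `ε` and the eigenvalues are affine. -/
theorem isBranchSystem_of_scalar {N : ℕ} {Wdot : Matrix (Fin N) (Fin N) ℝ} {α : Fin N → ℝ} {k : ℤ}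
    {a : ℝ} (ha : ∀ j, phase k (α j) = phase k a) {μ : Fin N → ℝ} {v : Fin N → Fin N → ℝ}
    (hμ : Function.Injective μ) (hv : ∀ i j, v i ⬝ᵥ v j = if i = j then 1 else 0)
    (hMv : ∀ i, Wdot.mulVec (v i) = μ i • v i) {γ : ℝ} (hγ : 0 < γ) :
    IsBranchSystem Wdot α k γ (fun ℓ j => (v ℓ j : ℂ)) (fun ℓ => phase k (α ℓ) * μ ℓ) 0 0 0 0 where
  pos := hγ
  orthonormal i j := by rw [cinner_ofReal, hv]; split_ifs <;> simp
  orth ℓ ε := by simp [cinner]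
  orth_limit ℓ := by simp [cinner]
  eigen ε _ ℓ := by
    ext j
    rw [fiberMat_mulVec, ← Matrix.mulVec_mulVec]
    simp only [Pi.zero_apply, smul_zero, add_zero, Pi.add_apply, Pi.smul_apply, smul_eq_mul,
      Dmat_mulVec, cW_mulVec_ofReal, hMv, branchValue, mul_zero, ha]
    push_cast
    ring
  injective ε hε i j hij := by
    simp only [branchValue, ha, Pi.zero_apply, mul_zero, add_zero] at hij
    -- Distinctness needs only `ε ≠ 0`, so the system exists on every interval `(0, γ)`.
    have h1 := mul_left_cancel₀ (Complex.ofReal_ne_zero.2 hε.1.ne') (add_left_cancel hij)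
    exact hμ (Complex.ofReal_injective (mul_left_cancel₀ (phase_ne_zero k a) h1))
  continuousOn ℓ := continuousOn_const
  tendsto_value ℓ := tendsto_const_nhds
  tendsto_vector ℓ := tendsto_const_nhds

/-! ### Several phases -/

/-- The matrix entry `⟨D Ẇ f_p, f_q⟩`. -/
def entry {N : ℕ} (Wdot : Matrix (Fin N) (Fin N) ℝ) (k : ℤ) (α : Fin N → ℝ)
    (f : Fin N → Fin N → ℂ) (q p : Fin N) : ℂ :=
  cinner ((Dmat k α * cW Wdot).mulVec (f p)) (f q)

/-- Eigendata of the diagonal blocks on the bands, with `b j` the band that contains `j`. -/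
structure IsBlockEigendata {N S : ℕ} (Wdot : Matrix (Fin N) (Fin N) ℝ) (α : Fin N → ℝ) (k : ℤ)
    (b : Fin N → Fin S) (μ : Fin N → ℝ) (f : Fin N → Fin N → ℂ) : Prop where
  injective : ∀ i j, b i = b j → μ i = μ j → i = j
  support : ∀ i j, b j ≠ b i → f i j = 0
  orthonormal : ∀ i j, cinner (f i) (f j) = if i = j then 1 else 0
  block_eigen : ∀ i j, b j = b i → (cW Wdot).mulVec (f i) j = μ i * f i j
  phase_eq_iff : ∀ i j, phase k (α i) = phase k (α j) ↔ b i = b j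

namespace IsBlockEigendata

variable {N S : ℕ} {Wdot : Matrix (Fin N) (Fin N) ℝ} {α : Fin N → ℝ} {k : ℤ}
  {b : Fin N → Fin S} {μ : Fin N → ℝ} {f : Fin N → Fin N → ℂ}

theorem Dmat_mulVec_eq (h : IsBlockEigendata Wdot α k b μ f) (p : Fin N) :
    (Dmat k α).mulVec (f p) = phase k (α p) • f p := by
  ext j
  rw [Dmat_mulVec, Pi.smul_apply, smul_eq_mul]
  by_cases hj : b j = b p
  · rw [(h.phase_eq_iff j p).2 hj]
  · rw [h.support p j hj, mul_zero, mul_zero]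

/-- The support of `f q` confines the sum to one band, where `D` is scalar and `f p` is an
eigenvector of the block. This supplies the diagonal-block hypothesis of `exists_branch`. -/
theorem entry_of_eq (h : IsBlockEigendata Wdot α k b μ f) {p q : Fin N} (hqp : b q = b p) :
    entry Wdot k α f q p = if p = q then phase k (α p) * μ p else 0 := by
  have h1 : entry Wdot k α f q p = (phase k (α p) * μ p) * cinner (f p) (f q) := by
    rw [entry, cinner, cinner, Finset.mul_sum]
    refine Finset.sum_congr rfl fun j _ => ?_
    by_cases hj : b j = b p
    · rw [← Matrix.mulVec_mulVec, Dmat_mulVec, h.block_eigen p j hj, (h.phase_eq_iff j p).2 hj]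
      ring
    · rw [h.support q j (hqp ▸ hj), star_zero, mul_zero, mul_zero, mul_zero]
  rw [h1, h.orthonormal]
  simp

theorem entry_self (h : IsBlockEigendata Wdot α k b μ f) (p : Fin N) :
    entry Wdot k α f p p = phase k (α p) * μ p := by
  rw [h.entry_of_eq rfl, if_pos rfl]

/-- In the basis `f` the fibre matrix is the diagonal of phases plus `ε` times `entry`, the form to
which `exists_branch` applies. -/
theorem fiberMat_mulVec_sum (h : IsBlockEigendata Wdot α k b μ f) (ε : ℝ) (y : Fin N → ℂ) :
    (fiberMat Wdot α k ε).mulVec (∑ p, y p • f p) =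
      ∑ q, (phase k (α q) * y q + ε * ∑ p, entry Wdot k α f q p * y p) • f q := by
  have h1 : ∀ p, (fiberMat Wdot α k ε).mulVec (f p) =
      phase k (α p) • f p + (ε : ℂ) • ∑ q, entry Wdot k α f q p • f q := by
    intro p
    rw [fiberMat_mulVec, h.Dmat_mulVec_eq]
    congr 2
    exact (sum_cinner_smul h.orthonormal _).symm
  rw [Matrix.mulVec_sum]
  simp only [Matrix.mulVec_smul, h1, smul_add, add_smul, Finset.sum_add_distrib, Finset.mul_sum,
    Finset.smul_sum, Finset.sum_smul, smul_smul]
  congr 1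
  · exact Finset.sum_congr rfl fun p _ => by rw [mul_comm]
  · rw [Finset.sum_comm]
    exact Finset.sum_congr rfl fun q _ => Finset.sum_congr rfl fun p _ => by
      rw [show y p * (ε * entry Wdot k α f q p) = ε * (entry Wdot k α f q p * y p) by ring]

theorem hatW_mulVec {L : Fin S → ℕ} (h : IsBlockEigendata Wdot α k b μ f)
    (hb : ∀ j s, j ∈ band N L s ↔ b j = s) (i : Fin N) :
    (Dmat k α * hatW L Wdot).mulVec (f i) = (phase k (α i) * (μ i : ℂ)) • f i := by
  have hex : ∀ j p, (∃ s, j ∈ band N L s ∧ p ∈ band N L s) ↔ b j = b p := fun j p => by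
    simp only [hb]
    exact ⟨fun ⟨s, h1, h2⟩ => h1.trans h2.symm, fun h1 => ⟨b p, h1, rfl⟩⟩
  ext j
  rw [← Matrix.mulVec_mulVec, Dmat_mulVec, Pi.smul_apply, smul_eq_mul]
  by_cases hj : b j = b i
  · have h1 : (hatW L Wdot).mulVec (f i) j = (cW Wdot).mulVec (f i) j := by
      rw [Matrix.mulVec, Matrix.mulVec, dotProduct, dotProduct]
      refine Finset.sum_congr rfl fun p _ => ?_
      simp only [hatW, Matrix.of_apply, hex, cW, Matrix.map_apply]
      by_cases hp : b p = b i
      · rw [if_pos (hj.trans hp.symm)]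
      · rw [h.support i p hp, mul_zero, mul_zero]
    rw [h1, h.block_eigen i j hj, (h.phase_eq_iff j i).2 hj]
    ring
  · have h1 : (hatW L Wdot).mulVec (f i) j = 0 := by
      rw [Matrix.mulVec, dotProduct]
      refine Finset.sum_eq_zero fun p _ => ?_
      simp only [hatW, Matrix.of_apply, hex]
      by_cases hp : b p = b i
      · rw [if_neg fun h2 => hj (h2.trans hp), zero_mul]
      · rw [h.support i p hp, mul_zero]
    rw [h1, h.support i j hj, mul_zero, mul_zero]

/-- Block eigendata continue to a system of branches with explicit responses. -/
theorem exists_isBranchSystem (h : IsBlockEigendata Wdot α k b μ f) :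
    ∃ γ₀ m u, IsBranchSystem Wdot α k γ₀ f (fun ℓ => phase k (α ℓ) * μ ℓ)
      (fun ℓ => branchInit (fun p => phase k (α p)) (entry Wdot k α f) ℓ ℓ)
      (fun ℓ => ∑ p, (if p = ℓ then 0 else
        branchInit (fun p => phase k (α p)) (entry Wdot k α f) ℓ p) • f p) m u := by
  have hc : ∀ p q, p ≠ q → phase k (α p) = phase k (α q) → entry Wdot k α f p q = 0 :=
    fun p q hpq hw => by
      rw [h.entry_of_eq ((h.phase_eq_iff _ _).1 hw), if_neg (Ne.symm hpq)]
  have hne : ∀ p q, p ≠ q → phase k (α p) = phase k (α q) →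
      phase k (α p) * (μ p : ℂ) ≠ phase k (α q) * μ q := by
    intro p q hpq hw he
    rw [hw] at he
    exact hpq (h.injective p q ((h.phase_eq_iff _ _).1 hw)
      (Complex.ofReal_injective (mul_left_cancel₀ (phase_ne_zero _ _) he)))
  have hd : ∀ i q, q ≠ i → phase k (α q) = phase k (α i) →
      entry Wdot k α f q q ≠ entry Wdot k α f i i := fun i q hqi hw => by
    rw [h.entry_self, h.entry_self]
    exact hne q i hqi hw
  choose x hx0 hx using fun i : Fin N => exists_branch (i := i) hc (hd i)
  let lamHat : Fin N → ℂ := fun ℓ => phase k (α ℓ) * μ ℓ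
  let m : Fin N → ℝ → ℂ := fun ℓ ε => x ℓ ε ℓ
  let u : Fin N → ℝ → Fin N → ℂ := fun ℓ ε => ∑ p, (if p = ℓ then 0 else x ℓ ε p) • f p
  have hxt : ∀ ℓ p, Tendsto (fun ε : ℝ => x ℓ ε p) (𝓝[>] 0)
      (𝓝 (branchInit (fun p => phase k (α p)) (entry Wdot k α f) ℓ p)) := by
    intro ℓ p
    have h1 : ContinuousAt (x ℓ) 0 := (hx ℓ).self_of_nhds.1
    have h2 : Tendsto (x ℓ) (𝓝 0) (𝓝 (x ℓ 0)) := h1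
    rw [hx0] at h2
    exact ((continuous_apply p).tendsto _).comp (h2.comp tendsto_ofReal_nhdsGT_zero)
  have hmt : ∀ ℓ, Tendsto (m ℓ) (𝓝[>] 0)
      (𝓝 (branchInit (fun p => phase k (α p)) (entry Wdot k α f) ℓ ℓ)) := fun ℓ => hxt ℓ ℓ
  have hinj : ∀ i j, i ≠ j → ∀ᶠ ε in 𝓝[>] (0 : ℝ),
      branchValue α k lamHat m i ε ≠ branchValue α k lamHat m j ε := by
    intro i j hij
    have hdm := (hmt i).sub (hmt j)
    -- Branches from the same phase separate at order `ε`, through distinct block eigenvalues; the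
    -- others are already separate at `ε = 0`.
    by_cases hw : phase k (α i) = phase k (α j)
    · have h1 := (tendsto_ofReal_nhdsGT_zero.mul hdm).const_add (lamHat i - lamHat j)
      rw [zero_mul, add_zero] at h1
      filter_upwards [h1.eventually_ne (sub_ne_zero.2 (hne i j hij hw)), self_mem_nhdsWithin]
        with ε h2 hε he
      have hε0 : (ε : ℂ) ≠ 0 := Complex.ofReal_ne_zero.2 (ne_of_gt hε)
      refine mul_ne_zero hε0 h2 ?_
      simp only [branchValue, hw] at he
      linear_combination he
    · have h1 := ((tendsto_ofReal_nhdsGT_zero.mul_const (lamHat i - lamHat j)).const_add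
        (phase k (α i) - phase k (α j))).add ((tendsto_ofReal_nhdsGT_zero.pow 2).mul hdm)
      rw [zero_mul, add_zero, zero_pow two_ne_zero, zero_mul, add_zero] at h1
      filter_upwards [h1.eventually_ne (sub_ne_zero.2 hw)] with ε h2 he
      refine h2 ?_
      simp only [branchValue] at he
      linear_combination he
  have hall := (eventually_all.2 fun ℓ => tendsto_ofReal_nhdsGT_zero.eventually (hx ℓ)).and
    (eventually_all.2 fun i => eventually_all.2 fun j =>
      eventually_imp_distrib_left.2 (hinj i j))
  obtain ⟨γ₀, hγ₀, hsub⟩ := mem_nhdsGT_iff_exists_Ioo_subset.1 hall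
  refine ⟨γ₀, m, u, hγ₀, h.orthonormal, fun ℓ ε => ?_, fun ℓ => ?_, fun ε hε ℓ => ?_,
    fun ε hε i j hij => ?_, fun ℓ => ?_, hmt, fun ℓ => ?_⟩
  · simp only [u, cinner_sum_left, cinner_smul_left, h.orthonormal]
    exact Finset.sum_eq_zero fun p _ => by split_ifs <;> simp
  · simp only [cinner_sum_left, cinner_smul_left, h.orthonormal]
    exact Finset.sum_eq_zero fun p _ => by split_ifs <;> simp
  · have hvec : f ℓ + (ε : ℂ) • u ℓ ε = ∑ p, (if p = ℓ then 1 else (ε : ℂ) * x ℓ ε p) • f p := by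
      have h1 : f ℓ = ∑ p, (if p = ℓ then (1 : ℂ) else 0) • f p := by simp
      conv_lhs => rw [h1]
      rw [Finset.smul_sum, ← Finset.sum_add_distrib]
      refine Finset.sum_congr rfl fun p _ => ?_
      rw [smul_smul, ← add_smul]
      congr 1
      split_ifs <;> simp
    rw [hvec, h.fiberMat_mulVec_sum, Finset.smul_sum]
    refine Finset.sum_congr rfl fun q _ => ?_
    rw [smul_smul, ((hsub hε).1 ℓ).2 q, h.entry_self, branchValue]
  · by_contra hne'
    exact (hsub hε).2 i j hne' hij
  · intro ε hε
    have h1 : ContinuousAt (fun ε : ℝ => x ℓ ε) ε :=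
      ContinuousAt.comp (g := x ℓ) ((hsub hε).1 ℓ).1 Complex.continuous_ofReal.continuousAt
    exact ((continuous_apply ℓ).continuousAt.comp h1).continuousWithinAt
  · refine tendsto_finsetSum _ fun p _ => Tendsto.smul_const ?_ _
    by_cases hp : p = ℓ
    · simp [hp]
    · simpa only [if_neg hp] using hxt ℓ p

theorem cinner_bandProj {L : Fin S → ℕ} (h : IsBlockEigendata Wdot α k b μ f)
    (hb : ∀ j s, j ∈ band N L s ↔ b j = s) (s : Fin S) (y : Fin N → ℂ) (q : Fin N) :
    cinner (bandProj L s y) (f q) = if b q = s then cinner y (f q) else 0 := by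
  simp only [cinner, bandProj, hb]
  split_ifs with hq
  · refine Finset.sum_congr rfl fun j _ => ?_
    by_cases hj : b j = s
    · rw [if_pos hj]
    · rw [h.support q j (hq ▸ hj), star_zero, mul_zero, mul_zero]
  · refine Finset.sum_eq_zero fun j _ => ?_
    by_cases hj : b j = s
    · rw [h.support q j (fun h1 => hq (h1.symm.trans hj)), star_zero, mul_zero]
    · rw [if_neg hj, zero_mul]

/-- By symmetry of `Ẇ`, the adjoint of `ẆD*` is `DẆ`; Parseval in the basis `f` then gives matrix
entries, and the projection keeps only the indices in the band. -/
theorem coupling_eq {L : Fin S → ℕ} (h : IsBlockEigendata Wdot α k b μ f) (hW : Wdot.IsSymm)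
    (hb : ∀ j s, j ∈ band N L s ↔ b j = s) (s : Fin S) (ℓ r : Fin N) :
    coupling L Wdot k α s (f ℓ) (f r) =
      ∑ q ∈ band N L s, entry Wdot k α f r q * entry Wdot k α f q ℓ := by
  have hadj : (cW Wdot * Dmat (-k) α).conjTranspose = Dmat k α * cW Wdot := by
    rw [Matrix.conjTranspose_mul]
    congr 1
    · rw [Dmat, Dmat, Matrix.diagonal_conjTranspose]
      congr 1
      ext j
      rw [Pi.star_apply, star_phase, neg_neg]
    · ext i j
      simp [cW, hW.apply i j]
  have h1 : ∀ q, cinner (f q) ((cW Wdot * Dmat (-k) α).mulVec (f r)) = entry Wdot k α f r q := by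
    intro q
    rw [← star_cinner, cinner_mulVec_left, hadj, star_cinner, entry]
  rw [coupling, cinner_eq_sum h.orthonormal,
    ← Finset.sum_subset (Finset.subset_univ (band N L s))]
  · refine Finset.sum_congr rfl fun q hq => ?_
    have hq' := (hb q s).1 hq
    rw [← star_cinner _ (f q), h.cinner_bandProj hb, h.cinner_bandProj hb, if_pos hq', if_pos hq',
      star_cinner, h1, entry, entry, mul_comm]
  · intro q _ hq
    rw [h.cinner_bandProj hb, if_neg fun h2 => hq ((hb q s).2 h2), zero_mul]

theorem sum_erase_sum_band {M : Type*} [AddCommMonoid M] {L : Fin S → ℕ}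
    (hb : ∀ j s, j ∈ band N L s ↔ b j = s) (s₀ : Fin S) (F : Fin S → Fin N → M) :
    ∑ s ∈ Finset.univ.erase s₀, ∑ r ∈ band N L s, F s r = ∑ r with b r ≠ s₀, F (b r) r := by
  have h1 : ∀ s, ∑ r ∈ band N L s, F s r = ∑ r, if b r = s then F s r else 0 := by
    intro s
    rw [← Finset.sum_filter]
    exact Finset.sum_congr (by ext r; simp [hb]) fun _ _ => rfl
  simp only [h1]
  rw [Finset.sum_comm, Finset.sum_filter]
  refine Finset.sum_congr rfl fun r _ => ?_
  rw [Finset.sum_ite_eq]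
  simp

/-- Regroups the sum over bands into the sum over individual basis vectors that occurs in
`branchInit`. -/
theorem sum_coupling {L : Fin S → ℕ} {β : Fin S → ℝ} (h : IsBlockEigendata Wdot α k b μ f)
    (hW : Wdot.IsSymm) (hb : ∀ j s, j ∈ band N L s ↔ b j = s) (hα : IsBanded L β α)
    (ℓ r : Fin N) :
    ∑ s ∈ Finset.univ.erase (b ℓ), (1 / (phase k (β (b ℓ)) - phase k (β s))) *
        coupling L Wdot k α s (f ℓ) (f r) =
      ∑ p with phase k (α p) ≠ phase k (α ℓ), entry Wdot k α f r p *
        (entry Wdot k α f p ℓ / (phase k (α ℓ) - phase k (α p))) := by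
  have hαb : ∀ j, α j = β (b j) := fun j => hα _ j ((hb j _).2 rfl)
  simp only [h.coupling_eq hW hb, Finset.mul_sum]
  rw [sum_erase_sum_band hb (b ℓ) fun s q => 1 / (phase k (β (b ℓ)) - phase k (β s)) *
    (entry Wdot k α f r q * entry Wdot k α f q ℓ)]
  refine Finset.sum_congr (by ext p; simp [h.phase_eq_iff]) fun p _ => ?_
  rw [hαb, hαb]
  ring

theorem branchInit_self {L : Fin S → ℕ} {β : Fin S → ℝ} (h : IsBlockEigendata Wdot α k b μ f)
    (hW : Wdot.IsSymm) (hb : ∀ j s, j ∈ band N L s ↔ b j = s) (hα : IsBanded L β α) (ℓ : Fin N) :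
    branchInit (fun p => phase k (α p)) (entry Wdot k α f) ℓ ℓ =
      lamHatHatFormula L Wdot k β α f (b ℓ) ℓ := by
  rw [lamHatHatFormula, h.sum_coupling hW hb hα, branchInit, if_pos rfl]

theorem sum_branchInit_smul {L : Fin S → ℕ} {β : Fin S → ℝ}
    (h : IsBlockEigendata Wdot α k b μ f) (hW : Wdot.IsSymm)
    (hb : ∀ j s, j ∈ band N L s ↔ b j = s) (hα : IsBanded L β α) (ℓ : Fin N) :
    ∑ p, (if p = ℓ then 0 else
        branchInit (fun p => phase k (α p)) (entry Wdot k α f) ℓ p) • f p =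
      fHatFormula L Wdot k β α (fun ℓ => phase k (α ℓ) * μ ℓ) f (b ℓ) ℓ := by
  have hαb : ∀ j, α j = β (b j) := fun j => hα _ j ((hb j _).2 rfl)
  have h1 : ∑ s ∈ Finset.univ.erase (b ℓ), ∑ r ∈ (band N L (b ℓ)).erase ℓ,
      ((1 / (phase k (α ℓ) * (μ ℓ : ℂ) - phase k (α r) * μ r)) *
        (1 / (phase k (β (b ℓ)) - phase k (β s))) * coupling L Wdot k α s (f ℓ) (f r)) • f r =
      ∑ r ∈ (band N L (b ℓ)).erase ℓ,
        branchInit (fun p => phase k (α p)) (entry Wdot k α f) ℓ r • f r := by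
    -- With the basis vector fixed, the inner sum over bands is `sum_coupling`.
    rw [Finset.sum_comm]
    refine Finset.sum_congr rfl fun r hr => ?_
    obtain ⟨hrℓ, hr⟩ := Finset.mem_erase.1 hr
    rw [← Finset.sum_smul]
    simp only [mul_assoc, ← Finset.mul_sum]
    rw [h.sum_coupling hW hb hα, branchInit, if_neg hrℓ,
      if_pos ((h.phase_eq_iff _ _).2 ((hb r _).1 hr)), h.entry_self, h.entry_self]
    congr 1
    ring
  rw [fHatFormula, h1, sum_erase_sum_band hb (b ℓ) fun s r =>
    ((1 / (phase k (β (b ℓ)) - phase k (β s))) *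
      cinner ((Dmat k α * cW Wdot).mulVec (f ℓ)) (f r)) • f r]
  have h2 : ∀ r ∈ Finset.univ.filter fun r => b r ≠ b ℓ,
      ((1 / (phase k (β (b ℓ)) - phase k (β (b r)))) *
        cinner ((Dmat k α * cW Wdot).mulVec (f ℓ)) (f r)) • f r =
      (if r = ℓ then 0 else branchInit (fun p => phase k (α p)) (entry Wdot k α f) ℓ r) • f r := by
    intro r hr
    have hr' := (Finset.mem_filter.1 hr).2
    have hrℓ : r ≠ ℓ := fun he => hr' (by rw [he])
    rw [if_neg hrℓ, branchInit, if_neg hrℓ, if_neg fun he => hr' ((h.phase_eq_iff _ _).1 he),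
      ← hαb, ← hαb, entry]
    congr 1
    ring
  -- The coefficients split by band: outside the band of `ℓ` they are the second double sum, inside
  -- it the first.
  rw [Finset.sum_congr rfl h2, ← Finset.sum_filter_add_sum_filter_not Finset.univ
    (fun r => b r ≠ b ℓ), add_comm]
  congr 1
  have h3 : Finset.univ.filter (fun r => ¬ b r ≠ b ℓ) = band N L (b ℓ) := by
    ext r; simp [hb]
  rw [h3, ← Finset.add_sum_erase _ _ ((hb ℓ _).2 rfl), if_pos rfl, zero_smul, zero_add]
  exact Finset.sum_congr rfl fun r hr => by rw [if_neg (Finset.ne_of_mem_erase hr)]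

end IsBlockEigendata

/-! ### Relabelling, and eigendata from admissibility -/

/-- A labelling fixes the branches only up to permutations inside the bands; such a permutation
merely reindexes the sums over each band. -/
theorem fHatFormula_comp_perm {N S : ℕ} (L : Fin S → ℕ) (Wdot : Matrix (Fin N) (Fin N) ℝ) (k : ℤ)
    (β : Fin S → ℝ) (α : Fin N → ℝ) (lamHat : Fin N → ℂ) (f : Fin N → Fin N → ℂ)
    (σ : Equiv.Perm (Fin N)) (hσ : ∀ j s, σ j ∈ band N L s ↔ j ∈ band N L s) (s₀ : Fin S)
    (ℓ : Fin N) :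
    fHatFormula L Wdot k β α (fun i => lamHat (σ i)) (fun i => f (σ i)) s₀ ℓ =
      fHatFormula L Wdot k β α lamHat f s₀ (σ ℓ) := by
  rw [fHatFormula, fHatFormula]
  congr 1
  · refine Finset.sum_congr rfl fun s _ => Finset.sum_equiv σ (fun r => ?_) fun r _ => rfl
    simp [hσ]
  · refine Finset.sum_congr rfl fun s _ => Finset.sum_equiv σ (fun r => ?_) fun r _ => rfl
    simp [hσ]

theorem IsAdmissible.exists_isBlockEigendata {N S : ℕ} {L : Fin S → ℕ}
    {Wdot : Matrix (Fin N) (Fin N) ℝ} (hW : IsAdmissible L Wdot) (hL : IsBandWidth N L)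
    {β : Fin S → ℝ} (hβ : β ∈ Gam S) {α : Fin N → ℝ} (hα : IsBanded L β α) {k : ℤ} (hk : k ≠ 0)
    {b : Fin N → Fin S} (hb : ∀ j s, j ∈ band N L s ↔ b j = s) :
    ∃ μ f, IsBlockEigendata Wdot α k b μ f ∧ ∀ ℓ, μ ℓ ≤ 0 := by
  obtain ⟨μ, v, hμ, hsupp, hv, hMv⟩ := exists_block_eigenbasis Wdot hW.symm (band N L) b hb
    fun s => by rw [hW.simple_block s, hL.card_band s]
  have hαb : ∀ j, α j = β (b j) := fun j => hα _ j ((hb j _).2 rfl)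
  refine ⟨μ, fun ℓ j => (v ℓ j : ℂ), ⟨hμ, fun i j hij => ?_, fun i j => ?_, fun i j hij => ?_,
    fun i j => ⟨fun he => ?_, fun he => ?_⟩⟩, fun ℓ => ?_⟩
  · rw [hsupp i j hij, Complex.ofReal_zero]
  · rw [cinner_ofReal, hv]
    split_ifs <;> simp
  · rw [cW_mulVec_ofReal, hMv i j hij, Complex.ofReal_mul]
  · rw [hαb, hαb] at he
    by_contra hne
    exact hβ k hk _ _ hne he
  · rw [hαb, hαb, he]
  -- The blocks need not have zero row sums, so the sign is read off from the full matrix: on a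
  -- vector supported in one band both quadratic forms agree.
  · have h1 : v ℓ ⬝ᵥ Wdot.mulVec (v ℓ) = μ ℓ * (v ℓ ⬝ᵥ v ℓ) := by
      rw [dotProduct, dotProduct, Finset.mul_sum]
      refine Finset.sum_congr rfl fun j _ => ?_
      by_cases hj : b j = b ℓ
      · rw [hMv ℓ j hj]
        ring
      · rw [hsupp ℓ j hj]
        ring
    have h2 := dotProduct_mulVec_nonpos Wdot hW.symm hW.nonneg hW.row_sum (v ℓ)
    rwa [h1, hv, if_pos rfl, mul_one] at h2

theorem IsAdmissible.exists_eigenbasis {N S : ℕ} {L : Fin S → ℕ}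
    {Wdot : Matrix (Fin N) (Fin N) ℝ} (hW : IsAdmissible L Wdot) :
    ∃ (μ : Fin N → ℝ) (v : Fin N → Fin N → ℝ), Function.Injective μ ∧
      (∀ i j, v i ⬝ᵥ v j = if i = j then 1 else 0) ∧ (∀ i, Wdot.mulVec (v i) = μ i • v i) ∧
      ∀ i, μ i ≤ 0 := by
  obtain ⟨μ, v, hμ, hv, hMv⟩ := exists_orthonormal_eigenbasis Wdot hW.symm
    (by rw [hW.simple, Fintype.card_fin])
  refine ⟨μ, v, hμ, hv, hMv, fun i => ?_⟩
  have h := dotProduct_mulVec_nonpos Wdot hW.symm hW.nonneg hW.row_sum (v i)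
  rwa [hMv, dotProduct_smul, hv, if_pos rfl, smul_eq_mul, mul_one] at h

theorem IsBranchSystem.inner_mode_eq_zero {N : ℕ} {Wdot : Matrix (Fin N) (Fin N) ℝ}
    {α : Fin N → ℝ} {k : ℤ} {γ₀ : ℝ} {f : Fin N → Fin N → ℂ} {lamHat lamHatHat : Fin N → ℂ}
    {fHat : Fin N → Fin N → ℂ} {m : Fin N → ℝ → ℂ} {u : Fin N → ℝ → Fin N → ℂ}
    (h : IsBranchSystem Wdot α k γ₀ f lamHat lamHatHat fHat m u) (ℓ : Fin N) :
    inner ℂ (mode k (f ℓ)) (mode k (fHat ℓ)) = 0 := by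
  rw [inner_mode, h.orth_limit]

theorem arg_response {N : ℕ} {α : Fin N → ℝ} {k : ℤ} {μ : Fin N → ℝ} (hμ : ∀ ℓ, μ ℓ ≤ 0)
    {i ℓ : Fin N} (hi : phase k (α i) = phase k (α ℓ)) (hne : phase k (α i) * (μ i : ℂ) ≠ 0) :
    ((phase k (α i) * (μ i : ℂ)).arg : Real.Angle) =
      ((phase k (α ℓ)).arg : Real.Angle) + Real.pi := by
  have h0 : μ i ≠ 0 := fun h => hne (by rw [h, Complex.ofReal_zero, mul_zero])
  rw [arg_phase_mul_of_neg k _ (lt_of_le_of_ne (hμ i) h0), hi]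

theorem orthonormal_comp_perm {N : ℕ} {f : Fin N → Fin N → ℂ}
    (hf : ∀ i j, cinner (f i) (f j) = if i = j then 1 else 0) (σ : Equiv.Perm (Fin N))
    (i j : Fin N) : cinner (f (σ i)) (f (σ j)) = if i = j then 1 else 0 := by
  rw [hf]
  exact if_congr σ.injective.eq_iff rfl rfl

end BandedRotation

end

/-! ### The theorem -/

open BandedRotation in
theorem theorem2 {N S : ℕ} (hS : 1 ≤ S) (L : Fin S → ℕ) (hL : IsBandWidth N L)
    (Wdot : Matrix (Fin N) (Fin N) ℝ) (hW : IsAdmissible L Wdot)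
    (β : Fin S → ℝ) (hβ : β ∈ Gam S) (α : Fin N → ℝ) (hα : IsBanded L β α) (k : ℤ) :
    -- the eigenvalues and eigenfunctions can be labelled
    (∃ γ lam g, IsLabelledEigendata Wdot α k γ lam g) ∧
    (S = 1 ∨ k = 0 → ∀ γ > 0, ∃ lam g, IsLabelledEigendata Wdot α k γ lam g) ∧
    -- every labelling has the following response
    ∀ (γ : ℝ) (lam : Fin N → ℝ → ℂ) (g : Fin N → ℝ → Fin N → ℂ),
      IsLabelledEigendata Wdot α k γ lam g →
      (∀ᶠ ε in 𝓝[>] (0 : ℝ), Function.Injective fun ℓ => lam ℓ ε) ∧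
      ∃ (lamHat lamHatHat : Fin N → ℂ) (f fHat : Fin N → Fin N → ℂ)
        (r : Fin N → ℝ → ℂ) (R : Fin N → ℝ → L2M N →L[ℂ] L2M N),
        (∀ ℓ m, cinner (f ℓ) (f m) = if ℓ = m then 1 else 0) ∧
        -- eigenvalue response
        (∀ ℓ, ∀ ε ∈ Ioo 0 γ, lam ℓ ε =
          phase k (α ℓ) + ε * lamHat ℓ + (ε : ℂ) ^ 2 * lamHatHat ℓ + r ℓ ε) ∧
        (∀ ℓ, r ℓ =o[𝓝[>] 0] fun ε : ℝ => ε ^ 2) ∧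
        -- eigenprojection response
        (∀ ℓ, ∀ ε ∈ Ioo 0 γ, lineProj (mode k (g ℓ ε)) =
          lineProj (mode k (f ℓ)) + (ε : ℂ) •
            (rankOneOp (mode k (f ℓ)) (mode k (fHat ℓ)) +
              rankOneOp (mode k (fHat ℓ)) (mode k (f ℓ))) + R ℓ ε) ∧
        (∀ ℓ, ∀ ε ∈ Ioo 0 γ, FiniteDimensional ℂ (R ℓ ε).range) ∧
        (∀ ℓ, R ℓ =o[𝓝[>] 0] fun ε : ℝ => ε) ∧
        (∀ ℓ, inner ℂ (mode k (f ℓ)) (mode k (fHat ℓ)) = 0) ∧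
        -- argument of the linear response
        (∀ ℓ, lamHat ℓ ≠ 0 →
          ((lamHat ℓ).arg : Real.Angle) = ((phase k (α ℓ)).arg : Real.Angle) + Real.pi) ∧
        -- a single band, or the zeroth Fourier mode
        (S = 1 ∨ k = 0 → ∀ ℓ,
          (phase k (β ⟨0, hS⟩) • cW Wdot).mulVec (f ℓ) = lamHat ℓ • f ℓ ∧
          lamHatHat ℓ = 0 ∧ fHat ℓ = 0 ∧ ∀ ε ∈ Ioo 0 γ, r ℓ ε = 0 ∧ R ℓ ε = 0) ∧
        -- several bands and a nonzero Fourier mode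
        (1 < S ∧ k ≠ 0 → ∀ ℓ,
          (Dmat k α * hatW L Wdot).mulVec (f ℓ) = lamHat ℓ • f ℓ ∧
          ∀ s, ℓ ∈ band N L s →
            (∀ j, j ∉ band N L s → f ℓ j = 0) ∧
            fHat ℓ = fHatFormula L Wdot k β α lamHat f s ℓ ∧
            lamHatHat ℓ = lamHatHatFormula L Wdot k β α f s ℓ) := by
  obtain ⟨b, hb⟩ := hL.exists_bandIndex
  have hαb : ∀ j, α j = β (b j) := fun j => hα _ j ((hb j _).2 rfl)
  by_cases hcase : S = 1 ∨ k = 0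
  · have ha : ∀ j, phase k (α j) = phase k (β ⟨0, hS⟩) := by
      intro j
      rcases hcase with rfl | rfl
      · rw [hαb, Subsingleton.elim (b j) ⟨0, hS⟩]
      · simp [phase]
    obtain ⟨μ, v, hμ, hv, hMv, hneg⟩ := hW.exists_eigenbasis
    have hsys := fun {γ : ℝ} (hγ : 0 < γ) => isBranchSystem_of_scalar ha hμ hv hMv hγ
    refine ⟨⟨1, _, _, (hsys one_pos).isLabelledEigendata⟩,
      fun _ γ hγ => ⟨_, _, (hsys hγ).isLabelledEigendata⟩, fun γ lam g hlam => ?_⟩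
    -- The branches are taken on the interval of the given labelling itself, so the remainders
    -- vanish on all of it.
    have h := hsys hlam.pos
    obtain ⟨hinj, σ, r, R, hσ, h1, h2, h3, h4, h5, h6⟩ := h.response hlam
    refine ⟨hinj, _, _, _, _, r, R, orthonormal_comp_perm h.orthonormal σ, h1, h2, h3, h4, h5,
      fun ℓ => h.inner_mode_eq_zero (σ ℓ), fun ℓ => arg_response hneg (hσ ℓ),
      fun _ ℓ => ⟨?_, rfl, rfl, fun ε hε => ?_⟩, fun hc => ?_⟩
    · ext j
      simp only [Matrix.smul_mulVec, Pi.smul_apply, smul_eq_mul, cW_mulVec_ofReal, hMv, ha]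
      push_cast
      ring
    · obtain ⟨hr, hR⟩ := h6 ℓ ε (by rwa [min_self])
      rw [hr, hR]
      constructor
      · simp
      · simp [lineError]
    · rcases hcase with rfl | rfl
      · exact absurd hc.1 (lt_irrefl _)
      · exact absurd rfl hc.2
  · have hk : k ≠ 0 := fun h => hcase (Or.inr h)
    obtain ⟨μ, f, hf, hneg⟩ := hW.exists_isBlockEigendata hL hβ hα hk hb
    obtain ⟨γ₀, m, u, h⟩ := hf.exists_isBranchSystem
    refine ⟨⟨γ₀, _, _, h.isLabelledEigendata⟩, fun hc => absurd hc hcase,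
      fun γ lam g hlam => ?_⟩
    obtain ⟨hinj, σ, r, R, hσ, h1, h2, h3, h4, h5, -⟩ := h.response hlam
    -- The relabelling preserves phases, and for `k ≠ 0` the phases determine the bands.
    have hσb : ∀ j s, σ j ∈ band N L s ↔ j ∈ band N L s := fun j s => by
      rw [hb, hb, (hf.phase_eq_iff _ _).1 (hσ j)]
    refine ⟨hinj, _, _, _, _, r, R, orthonormal_comp_perm h.orthonormal σ, h1, h2, h3, h4, h5,
      fun ℓ => h.inner_mode_eq_zero (σ ℓ), fun ℓ => arg_response hneg (hσ ℓ),
      fun hc => absurd hc hcase, fun _ ℓ => ⟨hf.hatW_mulVec hb (σ ℓ), fun s hs => ?_⟩⟩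
    obtain rfl := (hb _ _).1 ((hσb ℓ s).2 hs)
    refine ⟨fun j hj => hf.support _ _ fun hj' => hj ((hb _ _).2 hj'), ?_, ?_⟩
    · rw [hf.sum_branchInit_smul hW.symm hb hα]
      exact (fHatFormula_comp_perm L Wdot k β α _ f σ hσb _ ℓ).symm
    -- No reindexing is needed here: the second-order eigenvalue formula involves `f` only at its
    -- own label.
    · exact hf.branchInit_self hW.symm hb hα (σ ℓ)
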